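/- Consider $n$ participants. Participant $i$ reports claims according to a Poisson process $\{N_{i,t}\}_{t\ge 0}$ of intensity $\lambda_i>0$, with claim sizes $Y_{i,1},Y_{i,2},\dots$ that are non-negative, integrable, independent and identically distributed, and independent of $\{N_{i,t}\}_{t\ge0}$. Let $b_i=\mathrm E[Y_{i,1}]$ and $S_{i,t}=\sum_{k=1}^{N_{i,t}}Y_{i,k}$. The claim arrival processes $\{N_{i,t}\}_{t\ge0}$, $i=1,\dots,n$, are mutually independent, and so are the cumulative claim processes $\{S_{i,t}\}_{t\ge0}$, $i=1,\dots,n$. Let $\eta>0$ be a safety loading and $c_i=(1+\eta)\lambda_i b_i$. The stand-alone surplus of participant $i$ with initial reserve $\kappa$ is $V_{i,t}=c_it-S_{i,t}+\kappa$. Let $N_t=\sum_{i=1}^n N_{i,t}$ and $T_k=\inf\{t\ge 0: N_t=k\}$, and let $I_{j,k}$ be the indicator that the $k$th claim in the pool is generated by participant $j$. Let $A=(a_{i,j})$ be an $n\times n$ matrix with entries in $[0,1]$ and $\sum_{i=1}^n a_{i,j}=1$ for every $j$. Under the proportional occurrence-time sharing rule with allocation matrix $A$, participant $i$ pays at time $T_k$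 the amount $Z_{i,k}=\sum_{j=1}^n a_{i,j}\,I_{j,k}\,Y_{j,N_{j,T_k}}$, and the pooled surplus of participant $i$ is $V^{\mathrm{pool}}_{i,t}=c_it-\sum_{k=1}^{N_t}Z_{i,k}+\kappa$. Put $$\psi_i(\kappa)=\mathrm P\Big[\inf_{t\ge0}V_{i,t}<0\Big],\qquad \psi_i^{\mathrm{pool}}(\kappa)=\mathrm P\Big[\inf_{t\ge0}V^{\mathrm{pool}}_{i,t}<0\Big].$$ Assume that 1. (actuarial fairness) $\lambda_ib_i=\sum_{j=1}^n\lambda_ja_{i,j}b_j$ for every $i$; 2. (capacity constraint) $a_{i,j}b_j\le b_i$ for all $i,j$; 3. (scale loss family) $b_i>0$ for every $i$, and there is a random variable $W\ge0$ with $\mathrm E[W]=1$ such that $Y_{i,k}\overset{d}{=}b_iW$ for all $i$ and $k$. Then $\psi_i^{\mathrm{pool}}(\kappa)\le\psi_i(\kappa)$ for every participant $i=1,\dots,n$ and every $\kappa\ge0$. -/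

import Mathlib

open MeasureTheory ProbabilityTheory Filter
open scoped NNReal ENNReal

noncomputable section

namespace LinearRiskSharing

variable {Ω : Type*} [MeasurableSpace Ω]

/-- `N` is (a version with right-continuous paths of) a homogeneous Poisson process with
intensity `lam`: it starts at `0`, has independent increments, the increment over `(s, t]` is
Poisson distributed with parameter `lam * (t - s)`, and almost every path is non-decreasing and
right-continuous (for the discrete topology of `ℕ`). -/
structure IsPoissonProcess (lam : ℝ≥0) (N : ℝ≥0 → Ω → ℕ) (P : Measure Ω) : Prop where
  measurable : ∀ t, Measurable (N t)
  zero : ∀ᵐ ω ∂P, N 0 ω = 0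
  indep_increments : HasIndepIncrements N P
  law_increments : ∀ s t, s ≤ t →
    HasLaw (fun ω => N t ω - N s ω) (poissonMeasure (lam * (t - s))) P
  monotone_paths : ∀ᵐ ω ∂P, Monotone (fun t => N t ω)
  right_continuous_paths :
    ∀ᵐ ω ∂P, ∀ t, ContinuousWithinAt (fun s => N s ω) (Set.Ici t) t

/-- `S_t = ∑_{k=1}^{N_t} Y_k`. The size of the `k`-th claim is stored as `Y (k - 1)`. -/
def claimTotal (N : ℝ≥0 → Ω → ℕ) (Y : ℕ → Ω → ℝ) (t : ℝ≥0) (ω : Ω) : ℝ :=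
  ∑ k ∈ Finset.range (N t ω), Y k ω

/-- The loss model for `n` participants. Participant `i` reports claims according to a Poisson
process `N i` of intensity `lam i > 0`, with independent and identically distributed, non-negative,
integrable severities `Y i 0, Y i 1, …` that are independent of `N i`; the claim arrival processes
of different participants are mutually independent, and so are their cumulative claim
processes. -/
structure IsLossModel {n : ℕ} (lam : Fin n → ℝ≥0) (N : Fin n → ℝ≥0 → Ω → ℕ)
    (Y : Fin n → ℕ → Ω → ℝ) (P : Measure Ω) : Prop where
  intensity_pos : ∀ i, 0 < lam i
  poisson : ∀ i, IsPoissonProcess (lam i) (N i) P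
  measurable_claim : ∀ i k, Measurable (Y i k)
  claim_nonneg : ∀ i k, ∀ᵐ ω ∂P, 0 ≤ Y i k ω
  integrable_claim : ∀ i k, Integrable (Y i k) P
  claims_indep : ∀ i, iIndepFun (fun k => Y i k) P
  claims_identDistrib : ∀ i k, IdentDistrib (Y i k) (Y i 0) P P
  claims_indep_arrivals : ∀ i, IndepFun (fun ω k => Y i k ω) (fun ω t => N i t ω) P
  arrivals_indep : iIndepFun (fun i ω t => N i t ω) P
  totals_indep : iIndepFun (fun i ω t => claimTotal (N i) (Y i) t ω) P

/-- The mean severity `b_i = E[Y_{i,1}]`. -/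
def meanClaim {n : ℕ} (Y : Fin n → ℕ → Ω → ℝ) (P : Measure Ω) (i : Fin n) : ℝ :=
  ∫ ω, Y i 0 ω ∂P

/-- The contribution rate `c_i = (1 + η) λ_i b_i`. -/
def contributionRate {n : ℕ} (η : ℝ) (lam : Fin n → ℝ≥0) (Y : Fin n → ℕ → Ω → ℝ)
    (P : Measure Ω) (i : Fin n) : ℝ :=
  (1 + η) * (lam i * meanClaim Y P i)

/-- `N_t = ∑_i N_{i,t}`, the number of claims reported in the pool up to time `t`. -/
def poolCount {n : ℕ} (N : Fin n → ℝ≥0 → Ω → ℕ) (t : ℝ≥0) (ω : Ω) : ℕ :=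
  ∑ i, N i t ω

/-- `T_k = inf {t ≥ 0 : N_t = k}`, the time of the `k`-th claim in the pool (and `T_0 = 0`). -/
def occurrenceTime {n : ℕ} (N : Fin n → ℝ≥0 → Ω → ℕ) (k : ℕ) (ω : Ω) : ℝ≥0 :=
  sInf {t | poolCount N t ω = k}

open Classical in
/-- The indicator `I_{j,k}`, `k ≥ 1`, that the `k`-th claim in the pool is generated by
participant `j`, that is, that the count of participant `j` goes up between the occurrence times
`T_{k-1}` and `T_k`. The argument `k` of the Lean function stands for the `(k + 1)`-st claim. -/
def originIndicator {n : ℕ} (N : Fin n → ℝ≥0 → Ω → ℕ) (j : Fin n) (k : ℕ) (ω : Ω) : ℝ :=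
  if N j (occurrenceTime N k ω) ω < N j (occurrenceTime N (k + 1) ω) ω then 1 else 0

/-- The payment `Z_{i,k} = ∑_j a_{i,j} I_{j,k} Y_{j, N_{j,T_k}}` of participant `i` at the `k`-th
occurrence time. The argument `k` of the Lean function stands for the `(k + 1)`-st claim, and the
claim `Y_{j, m}` is stored as `Y j (m - 1)`. -/
def pooledPayment {n : ℕ} (A : Matrix (Fin n) (Fin n) ℝ) (N : Fin n → ℝ≥0 → Ω → ℕ)
    (Y : Fin n → ℕ → Ω → ℝ) (i : Fin n) (k : ℕ) (ω : Ω) : ℝ :=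
  ∑ j, A i j * originIndicator N j k ω * Y j (N j (occurrenceTime N (k + 1) ω) ω - 1) ω

/-- The surplus `V_t = c t - S_t + κ` with initial reserve `κ`, where `S` is the cumulative claim
process. -/
def surplus (c κ : ℝ) (S : ℝ≥0 → Ω → ℝ) (t : ℝ≥0) (ω : Ω) : ℝ :=
  c * t - S t ω + κ

/-- The infinite-time ruin probability `P[inf_{t ≥ 0} V_t < 0]`. The infimum is taken in the
extended reals, so that it is the true one for paths that are unbounded below. -/
def ruinProb (P : Measure Ω) (V : ℝ≥0 → Ω → ℝ) : ℝ≥0∞ :=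
  P {ω | (⨅ t : ℝ≥0, ((V t ω : ℝ) : EReal)) < 0}

/-- The stand-alone ruin probability `ψ_i(κ)` of participant `i`. -/
def standAloneRuinProb {n : ℕ} (η : ℝ) (lam : Fin n → ℝ≥0) (N : Fin n → ℝ≥0 → Ω → ℕ)
    (Y : Fin n → ℕ → Ω → ℝ) (P : Measure Ω) (i : Fin n) (κ : ℝ) : ℝ≥0∞ :=
  ruinProb P (surplus (contributionRate η lam Y P i) κ (claimTotal (N i) (Y i)))

/-- The ruin probability `ψ_i^pool(κ)` of participant `i` inside the pool; the cumulative amount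
borne by participant `i` is `∑_{k=1}^{N_t} Z_{i,k}`, and the contribution rate is unchanged. -/
def pooledRuinProb {n : ℕ} (η : ℝ) (A : Matrix (Fin n) (Fin n) ℝ) (lam : Fin n → ℝ≥0)
    (N : Fin n → ℝ≥0 → Ω → ℕ) (Y : Fin n → ℕ → Ω → ℝ) (P : Measure Ω) (i : Fin n) (κ : ℝ) :
    ℝ≥0∞ :=
  ruinProb P (surplus (contributionRate η lam Y P i) κ
    (claimTotal (poolCount N) (pooledPayment A N Y i)))

/-- Actuarial fairness: `λ_i b_i = ∑_j λ_j a_{i,j} b_j` for every `i`. -/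
def ActuariallyFair {n : ℕ} (A : Matrix (Fin n) (Fin n) ℝ) (lam : Fin n → ℝ≥0)
    (b : Fin n → ℝ) : Prop :=
  ∀ i, lam i * b i = ∑ j, lam j * A i j * b j

/-- The capacity constraint: `a_{i,j} b_j ≤ b_i` for all `i, j`. -/
def CapacityConstraint {n : ℕ} (A : Matrix (Fin n) (Fin n) ℝ) (b : Fin n → ℝ) : Prop :=
  ∀ i j, A i j * b j ≤ b i

/-- Scale loss family: there is a random variable `W ≥ 0` with mean `1`, on some probability
space, such that every `Y_{i,k}` has the law of `b_i W`, where `b_i > 0`. Only the law of `W`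
matters, so nothing is lost by taking its probability space in the lowest universe. -/
def ScaleLossFamily {n : ℕ} (Y : Fin n → ℕ → Ω → ℝ) (b : Fin n → ℝ) (P : Measure Ω) : Prop :=
  (∀ i, 0 < b i) ∧
  ∃ (Ω' : Type) (_ : MeasurableSpace Ω') (Q : Measure Ω') (W : Ω' → ℝ),
    IsProbabilityMeasure Q ∧ Measurable W ∧ (∀ ω, 0 ≤ W ω) ∧ Integrable W Q ∧
    ∫ ω, W ω ∂Q = 1 ∧
    ∀ i k, IdentDistrib (Y i k) (fun ω => b i * W ω) P Q

end LinearRiskSharing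

end

noncomputable section

set_option linter.unusedSectionVars false

namespace LinearRiskSharing

section

variable {Ω : Type*}

/-! Almost surely no two claims of the pool coincide, so the pooled losses of participant `i` are
the linear combination of the individual compound Poisson processes with weights `A i`
(`IsLossModel.ae_claimTotal_poolCount_eq`). Both surpluses are therefore of one type, with weights
`A i` or `Pi.single i 1` and the same premium rate `c`, and right-continuity lets ruin be read off
at dyadic times (`IsLossModel.ruinProb_eq`).

For weights `w`, the ruin probability `ψ` should solve the integrated renewal equation `c ψ(v) = ∑
j, λ_j E ∫_0^{w_j Y_j} ψ(v - x) dx`. Only one half is needed for each side: `≤` for the pool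
(`IsLossModel.mul_dyadicRuin_le`) and `≥` for the stand-alone surplus
(`IsLossModel.le_mul_dyadicRuin_single`). Both come from the random walk on a dyadic grid:
conditioning on the first increment and integrating over the level gives an exact identity
(`intervalIntegral_supTail_eq`). Dividing by the mesh and letting it tend to zero yields the
inequalities, because over a short period the losses are a single claim up to second order
(`integral_sublinear_ge`, `IsLossModel.integral_sublinear_sharedTotal_le`).

The comparison is `sum_integral_primitive_le`. For antitone `φ`, `G(y) = ∫_0^y φ(v - x) dx` is
convex with `G(0) = 0`, so `G(r y) ≤ r G(y)` for `0 ≤ r ≤ 1` and `y ≥ 0`. The scale family makes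
`a_{i,j} Y_j` distributed as `r_j Y_i` with `r_j = a_{i,j} b_j / b_i`, the capacity constraint gives
`r_j ≤ 1`, and fairness gives `∑ j, λ_j r_j = λ_i`. Hence the pooled ruin probability is a
subsolution of the stand-alone equation. Its integral operator contracts uniform errors by `λ_i b_i
/ c = 1 / (1 + η)`, so iteration puts the subsolution below the supersolution
(`IsLossModel.dyadicRuin_le`). -/

/-- The `k`-th point of the dyadic time grid with mesh `2⁻ᵐ`. -/
def dyadicTime (m k : ℕ) : ℝ≥0 := k / 2 ^ m

/-! ### Pathwise form of the pooled losses. -/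

section Paths

variable {n : ℕ} {N : Fin n → ℝ≥0 → Ω → ℕ} {ω : Ω}

lemma monotone_poolCount (hmono : ∀ j, Monotone fun t => N j t ω) :
    Monotone fun t => poolCount N t ω :=
  fun _ _ h => Finset.sum_le_sum fun j _ => hmono j h

/-- Since `ℕ` is discrete, right-continuity means being constant just to the right of each point. -/
lemma exists_forall_eq_of_continuousWithinAt {f : ℝ≥0 → ℕ} {t : ℝ≥0}
    (h : ContinuousWithinAt f (Set.Ici t) t) : ∃ u > t, ∀ s, t ≤ s → s < u → f s = f t := by
  have h1 : ∀ᶠ s in nhdsWithin t (Set.Ici t), f s = f t := by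
    have := h.tendsto
    rw [nhds_discrete, tendsto_pure] at this
    exact this
  rw [eventually_iff, mem_nhdsGE_iff_exists_Ico_subset] at h1
  obtain ⟨u, hu, hsub⟩ := h1
  exact ⟨u, hu, fun s h1 h2 => hsub ⟨h1, h2⟩⟩

lemma continuousWithinAt_poolCount
    (hrc : ∀ j t, ContinuousWithinAt (fun s => N j s ω) (Set.Ici t) t) (t : ℝ≥0) :
    ContinuousWithinAt (fun s => poolCount N s ω) (Set.Ici t) t := by
  unfold poolCount
  exact tendsto_finsetSum _ fun j _ => (hrc j t)

/-- A discrete intermediate value theorem: along a grid on which the pooled count rises by at most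
one per step, no level is skipped. -/
lemma exists_poolCount_eq (h0 : ∀ j, N j 0 ω = 0) (hmono : ∀ j, Monotone fun t => N j t ω)
    (hsimple : ∀ K : ℕ, ∃ m : ℕ, ∀ k < K * 2 ^ m,
      poolCount N (dyadicTime m (k + 1)) ω ≤ poolCount N (dyadicTime m k) ω + 1)
    {t : ℝ≥0} {k : ℕ} (hk : k ≤ poolCount N t ω) : ∃ s, poolCount N s ω = k := by
  obtain ⟨K, hK⟩ := exists_nat_ge t
  obtain ⟨m, hm⟩ := hsimple K
  have hend : dyadicTime m (K * 2 ^ m) = K := by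
    simp [dyadicTime]
  have key : ∀ l ≤ K * 2 ^ m, ∀ k ≤ poolCount N (dyadicTime m l) ω,
      ∃ s, poolCount N s ω = k := by
    intro l
    induction l with
    | zero =>
      intro _ k hk
      refine ⟨0, ?_⟩
      have : poolCount N (dyadicTime m 0) ω = 0 := by simp [poolCount, dyadicTime, h0]
      have h2 : poolCount N 0 ω = 0 := by simp [poolCount, h0]
      omega
    | succ l ih =>
      intro hl k hk
      have h1 := hm l (by omega)
      rcases Nat.lt_or_ge (poolCount N (dyadicTime m l) ω) k with h | h
      · exact ⟨dyadicTime m (l + 1), by omega⟩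
      · exact ih (by omega) k h
  refine key _ le_rfl k (hk.trans ?_)
  rw [hend]
  exact monotone_poolCount hmono hK

/-- The infimum is attained: the count is constant just to the right of it, and that stretch
contains a point of the level set. -/
lemma poolCount_occurrenceTime
    (hrc : ∀ j t, ContinuousWithinAt (fun s => N j s ω) (Set.Ici t) t) {k : ℕ}
    (hne : ∃ s, poolCount N s ω = k) : poolCount N (occurrenceTime N k ω) ω = k := by
  obtain ⟨u, hu, h⟩ := exists_forall_eq_of_continuousWithinAt
    (continuousWithinAt_poolCount hrc (occurrenceTime N k ω))
  obtain ⟨s, hs, hsu⟩ := exists_lt_of_csInf_lt (s := {t | poolCount N t ω = k}) hne hu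
  rw [← h s (csInf_le (OrderBot.bddBelow _) hs) hsu]
  exact hs

/-- Between consecutive occurrence times exactly one participant reports exactly one claim, hence
the payment at an occurrence time is the increment of the shared cumulative claims. -/
lemma pooledPayment_eq {A : Matrix (Fin n) (Fin n) ℝ} {Y : Fin n → ℕ → Ω → ℝ} {i : Fin n} {k : ℕ}
    (hmono : ∀ j, Monotone fun t => N j t ω)
    (h1 : poolCount N (occurrenceTime N k ω) ω = k)
    (h2 : poolCount N (occurrenceTime N (k + 1) ω) ω = k + 1) :
    pooledPayment A N Y i k ω =
      ∑ j, A i j * (claimTotal (N j) (Y j) (occurrenceTime N (k + 1) ω) ω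
        - claimTotal (N j) (Y j) (occurrenceTime N k ω) ω) := by
  set s := occurrenceTime N k ω
  set t := occurrenceTime N (k + 1) ω
  have hst : s ≤ t := by
    by_contra! h
    have := monotone_poolCount hmono h.le
    simp only at this
    omega
  have hle : ∀ j, N j s ω ≤ N j t ω := fun j => hmono j hst
  have hstep : ∀ j, N j t ω ≤ N j s ω + 1 := by
    intro j
    have hsum : ∑ l, (N l t ω - N l s ω) = 1 := by
      rw [Finset.sum_tsub_distrib _ fun l _ => hle l]
      unfold poolCount at h1 h2
      omega
    have := Finset.single_le_sum (f := fun l => N l t ω - N l s ω) (fun _ _ => Nat.zero_le _)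
      (Finset.mem_univ j)
    omega
  unfold pooledPayment
  refine Finset.sum_congr rfl fun j _ => ?_
  rw [mul_assoc]
  congr 1
  unfold originIndicator claimTotal
  rcases (hle j).lt_or_eq with h | h
  · have : N j t ω = N j s ω + 1 := le_antisymm (hstep j) h
    -- The stored index `N j t ω - 1` equals `N j s ω`, which is exactly the new summand.
    rw [if_pos h, this, Finset.sum_range_succ]
    simp
  · rw [if_neg h.not_lt, h]
    simp

/-- The cumulative amount borne by a participant of the pool is the linear combination of the
cumulative claim processes given by the allocation matrix. -/
lemma claimTotal_poolCount_eq {A : Matrix (Fin n) (Fin n) ℝ} {Y : Fin n → ℕ → Ω → ℝ} {i : Fin n}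
    (h0 : ∀ j, N j 0 ω = 0) (hmono : ∀ j, Monotone fun t => N j t ω)
    (hrc : ∀ j t, ContinuousWithinAt (fun s => N j s ω) (Set.Ici t) t)
    (hsimple : ∀ K : ℕ, ∃ m : ℕ, ∀ k < K * 2 ^ m,
      poolCount N (dyadicTime m (k + 1)) ω ≤ poolCount N (dyadicTime m k) ω + 1) (t : ℝ≥0) :
    claimTotal (poolCount N) (pooledPayment A N Y i) t ω =
      ∑ j, A i j * claimTotal (N j) (Y j) t ω := by
  have hocc : ∀ k ≤ poolCount N t ω, poolCount N (occurrenceTime N k ω) ω = k :=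
    fun k hk => poolCount_occurrenceTime hrc (exists_poolCount_eq h0 hmono hsimple hk)
  have key : ∀ K ≤ poolCount N t ω, ∑ k ∈ Finset.range K, pooledPayment A N Y i k ω =
      ∑ j, A i j * claimTotal (N j) (Y j) (occurrenceTime N K ω) ω := by
    intro K
    induction K with
    | zero =>
      intro _
      have : occurrenceTime N 0 ω = 0 := by
        have hmem : (0 : ℝ≥0) ∈ {t | poolCount N t ω = 0} := by simp [poolCount, h0]
        exact le_antisymm (csInf_le (OrderBot.bddBelow _) hmem) (zero_le)
      simp [this, claimTotal, h0]
    | succ K ih =>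
      intro hK
      rw [Finset.sum_range_succ, ih (by omega),
        pooledPayment_eq hmono (hocc K (by omega)) (hocc (K + 1) hK), ← Finset.sum_add_distrib]
      refine Finset.sum_congr rfl fun j _ => by ring
  unfold claimTotal at key ⊢
  rw [key _ le_rfl]
  refine Finset.sum_congr rfl fun j _ => ?_
  suffices N j (occurrenceTime N (poolCount N t ω) ω) ω = N j t ω by rw [this]
  have hT : occurrenceTime N (poolCount N t ω) ω ≤ t :=
    csInf_le (OrderBot.bddBelow _) (by simp)
  have hsum := hocc _ le_rfl
  -- Each individual count can only grow between the last occurrence time and `t`, while their sum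
  -- is the same at both; so none of them changes.
  refine (Finset.sum_eq_sum_iff_of_le (s := Finset.univ)
    (f := fun l => N l (occurrenceTime N (poolCount N t ω) ω) ω) (g := fun l => N l t ω)
    fun l _ => hmono l hT).1 hsum j (Finset.mem_univ j)

end Paths

end

variable {Ω : Type*} [MeasurableSpace Ω]

/-! ### Tail functions of suprema. -/

/-- The tail function `u ↦ P[sup_i Z_i > u]` of the supremum of a family of random variables. -/
def supTail {ι : Type*} (P : Measure Ω) (Z : ι → Ω → ℝ) (u : ℝ) : ℝ :=
  P.real {ω | ∃ i, u < Z i ω}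

section SupTail

variable {ι : Type*} {P : Measure Ω} [IsProbabilityMeasure P] {Z : ι → Ω → ℝ}

lemma supTail_nonneg (u : ℝ) : 0 ≤ supTail P Z u := measureReal_nonneg

lemma supTail_le_one (u : ℝ) : supTail P Z u ≤ 1 := measureReal_le_one

lemma antitone_supTail : Antitone (supTail P Z) := fun _ _ h =>
  measureReal_mono fun _ ⟨i, hi⟩ => ⟨i, h.trans_lt hi⟩

lemma supTail_eq_one {u : ℝ} (h : ∀ᵐ ω ∂P, ∃ i, u < Z i ω) : supTail P Z u = 1 := by
  have : {ω | ∃ i, u < Z i ω} =ᵐ[P] Set.univ := by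
    rw [ae_eq_univ]; exact h
  rw [supTail, measureReal_congr this]
  simp

lemma measurableSet_exists_lt [Countable ι] (hZ : ∀ i, Measurable (Z i)) (u : ℝ) :
    MeasurableSet {ω | ∃ i, u < Z i ω} := by
  simp only [Set.ofPred_exists]
  exact MeasurableSet.iUnion fun i => measurableSet_lt measurable_const (hZ i)

/-- The tail function of a supremum is right-continuous. -/
lemma tendsto_supTail_add (u : ℝ) :
    Tendsto (fun k : ℕ => supTail P Z (u + 1 / ((k : ℝ) + 1))) atTop (nhds (supTail P Z u)) := by
  have hU : {ω | ∃ i, u < Z i ω} = ⋃ k : ℕ, {ω | ∃ i, u + 1 / ((k : ℝ) + 1) < Z i ω} := by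
    ext ω
    simp only [Set.mem_ofPred_eq, Set.mem_iUnion]
    constructor
    · rintro ⟨i, hi⟩
      obtain ⟨k, hk⟩ := exists_nat_one_div_lt (sub_pos.2 hi)
      exact ⟨k, i, by linarith⟩
    · rintro ⟨k, i, hi⟩
      exact ⟨i, by have : (0 : ℝ) < 1 / ((k : ℝ) + 1) := by positivity
                   linarith⟩
  unfold supTail
  rw [hU]
  refine (ENNReal.tendsto_toReal (measure_ne_top _ _)).comp
    (tendsto_measure_iUnion_atTop fun k l hkl ω ⟨i, hi⟩ => ⟨i, lt_of_le_of_lt ?_ hi⟩)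
  gcongr

/-- Continuity from above along integer levels, whose intersection is null because the supremum is
almost surely finite; monotonicity extends the limit to real levels. -/
lemma tendsto_supTail_atTop [Countable ι] (hZ : ∀ i, Measurable (Z i))
    (hb : ∀ᵐ ω ∂P, BddAbove (Set.range fun i => Z i ω)) :
    Tendsto (supTail P Z) atTop (nhds 0) := by
  have h0 : P (⋂ k : ℕ, {ω | ∃ i, (k : ℝ) < Z i ω}) = 0 := by
    refine measure_mono_null (t := {ω | ¬ BddAbove (Set.range fun i => Z i ω)}) ?_ hb
    rintro ω hω ⟨B, hB⟩
    simp only [Set.mem_iInter, Set.mem_ofPred_eq] at hω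
    obtain ⟨k, hk⟩ := exists_nat_ge B
    obtain ⟨i, hi⟩ := hω k
    have : Z i ω ≤ B := hB ⟨i, rfl⟩
    linarith
  have ht := tendsto_measure_iInter_atTop (μ := P)
    (s := fun k : ℕ => {ω | ∃ i, (k : ℝ) < Z i ω})
    (fun k => (measurableSet_exists_lt hZ _).nullMeasurableSet)
    (fun k l hkl ω ⟨i, hi⟩ => ⟨i, lt_of_le_of_lt (by exact_mod_cast hkl) hi⟩)
    ⟨0, measure_ne_top _ _⟩
  rw [h0] at ht
  have ht' := (ENNReal.tendsto_toReal ENNReal.zero_ne_top).comp ht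
  have h1 : Tendsto (fun k : ℕ => supTail P Z k) atTop (nhds 0) := ht'
  have h2 := tendsto_atTop_ciInf (antitone_supTail (P := P) (Z := Z))
    ⟨0, by rintro _ ⟨u, rfl⟩; exact supTail_nonneg u⟩
  rwa [tendsto_nhds_unique (h2.comp tendsto_natCast_atTop_atTop) h1] at h2

end SupTail

/-! ### Integrals of bounded antitone functions. -/

section Antitone

/-- For an antitone function with values in `[0, 1]`, interval integrals are controlled by the
length of the interval. -/
lemma abs_intervalIntegral_le {φ : ℝ → ℝ} (h0 : ∀ u, 0 ≤ φ u) (h1 : ∀ u, φ u ≤ 1) (x y : ℝ) :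
    |∫ u in x..y, φ u| ≤ |y - x| := by
  have := intervalIntegral.norm_integral_le_of_norm_le_const (a := x) (b := y) (C := 1) (f := φ)
    fun u _ => by rw [Real.norm_of_nonneg (h0 u)]; exact h1 u
  simpa using this

lemma continuous_intervalIntegral_add {φ : ℝ → ℝ} (hφ : Antitone φ) (x : ℝ) :
    Continuous fun d => ∫ u in x..x + d, φ u :=
  (intervalIntegral.continuous_primitive (fun _ _ => hφ.intervalIntegrable) x).comp
    (continuous_const.add continuous_id)

end Antitone

/-! ### Renewal equation for the maximum of a random walk. -/

section Walk

variable {P : Measure Ω} [IsProbabilityMeasure P] {X : ℕ → Ω → ℝ}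

/-- The claim surplus random walk: claims `X i` minus the premium `a` per step. -/
def claimWalk (X : ℕ → Ω → ℝ) (a : ℝ) (k : ℕ) (ω : Ω) : ℝ :=
  ∑ i ∈ Finset.range k, X i ω - k * a

lemma measurable_claimWalk (hX : ∀ i, Measurable (X i)) (a : ℝ) (k : ℕ) :
    Measurable (claimWalk X a k) := by
  unfold claimWalk; fun_prop

/-- With `identDistrib_tail`, this says that after its first step the walk restarts afresh,
independently of that step. -/
lemma indepFun_zero_tail (hX : ∀ i, Measurable (X i)) (hind : iIndepFun X P) :
    IndepFun (X 0) (fun ω i => X (i + 1) ω) P := by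
  refine IndepFun.indepFun_process (hX 0) (fun i => hX (i + 1)) fun I => ?_
  have h := hind.indepFun_finset {0} (I.map ⟨Nat.succ, Nat.succ_injective⟩)
    (by simp) hX
  exact h.comp (φ := fun (f : ({0} : Finset ℕ) → ℝ) => f ⟨0, by simp⟩)
    (ψ := fun (f : I.map ⟨Nat.succ, Nat.succ_injective⟩ → ℝ) (i : I) => f ⟨i + 1, by simp⟩)
    (by fun_prop) (by fun_prop)

lemma identDistrib_tail (hind : iIndepFun X P)
    (hid : ∀ i, IdentDistrib (X i) (X 0) P P) :
    IdentDistrib (fun ω i => X (i + 1) ω) (fun ω i => X i ω) P P :=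
  IdentDistrib.pi (fun i => (hid (i + 1)).trans (hid i).symm)
    (hind.precomp (add_left_injective 1)) hind

lemma claimWalk_succ (a : ℝ) (k : ℕ) (ω : Ω) :
    claimWalk X a (k + 1) ω = X 0 ω - a + claimWalk (fun i => X (i + 1)) a k ω := by
  unfold claimWalk
  rw [Finset.sum_range_succ']
  push_cast
  ring

/-- The tail of the maximum of the claim surplus walk satisfies a renewal equation. -/
lemma supTail_claimWalk_eq (hX : ∀ i, Measurable (X i)) (hind : iIndepFun X P)
    (hid : ∀ i, IdentDistrib (X i) (X 0) P P) (a : ℝ) {u : ℝ} (hu : 0 ≤ u) :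
    supTail P (claimWalk X a) u = ∫ ω, supTail P (claimWalk X a) (u + a - X 0 ω) ∂P := by
  let W : ℝ → Set (ℕ → ℝ) := fun v => {y | ∃ k : ℕ, v < ∑ i ∈ Finset.range k, y i - k * a}
  let E : Set (ℝ × (ℕ → ℝ)) := {p | p.2 ∈ W (u + a - p.1)}
  have hE : MeasurableSet E := by
    have : E = ⋃ k : ℕ, {p | u + a - p.1 < ∑ i ∈ Finset.range k, p.2 i - k * a} := by
      ext p
      simp [E, W]
    rw [this]
    exact MeasurableSet.iUnion fun k => measurableSet_lt (by fun_prop) (by fun_prop)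
  have hmY : Measurable fun ω i => X i ω := measurable_pi_lambda _ fun i => hX i
  have hmS : Measurable fun ω i => X (i + 1) ω := measurable_pi_lambda _ fun i => hX (i + 1)
  have hset : {ω | ∃ k, u < claimWalk X a k ω} =
      (fun ω => (X 0 ω, fun i => X (i + 1) ω)) ⁻¹' E := by
    ext ω
    simp only [Set.mem_ofPred_eq, Set.mem_preimage, E, W]
    constructor
    · rintro ⟨k, hk⟩
      cases k with
      -- The walk starts at `0`, which does not exceed `u`; the equation fails for negative levels,
      -- so `0 ≤ u` is essential here.
      | zero => simp [claimWalk] at hk; linarith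
      | succ k =>
        rw [claimWalk_succ] at hk
        exact ⟨k, by unfold claimWalk at hk; linarith⟩
    · rintro ⟨k, hk⟩
      refine ⟨k + 1, ?_⟩
      rw [claimWalk_succ]
      unfold claimWalk
      linarith
  have hW : ∀ v, (P.map fun ω i => X (i + 1) ω) (W v) = P {ω | ∃ k, v < claimWalk X a k ω} := by
    intro v
    rw [(identDistrib_tail hind hid).map_eq, Measure.map_apply hmY]
    · rfl
    · simp only [W, Set.ofPred_exists]
      exact MeasurableSet.iUnion fun k => measurableSet_lt (by fun_prop) (by fun_prop)
  have hlaw := (indepFun_iff_map_prod_eq_prod_map_map (hX 0).aemeasurable hmS.aemeasurable).1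
    (indepFun_zero_tail hX hind)
  have hP : P {ω | ∃ k, u < claimWalk X a k ω} =
      ∫⁻ ω, P {ω' | ∃ k, u + a - X 0 ω < claimWalk X a k ω'} ∂P := by
    rw [hset, ← Measure.map_apply ((hX 0).prodMk hmS) hE, hlaw,
      Measure.prod_apply hE, lintegral_map (measurable_measure_prodMk_left hE) (hX 0)]
    refine lintegral_congr fun ω => ?_
    rw [← hW]
    rfl
  unfold supTail
  rw [measureReal_def, hP, ← integral_toReal]
  · rfl
  · have hanti : Antitone fun v => P {ω | ∃ k, v < claimWalk X a k ω} :=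
      fun _ _ h => measure_mono fun _ ⟨i, hi⟩ => ⟨i, h.trans_lt hi⟩
    exact (hanti.measurable.comp (measurable_const.sub (hX 0))).aemeasurable
  · exact ae_of_all _ fun _ => measure_lt_top _ _

/-- By the strong law the premium eventually outweighs the claims, so the walk is eventually
non-positive. -/
lemma bddAbove_claimWalk (hind : iIndepFun X P)
    (hid : ∀ i, IdentDistrib (X i) (X 0) P P) (hint : Integrable (X 0) P) {a : ℝ}
    (ha : ∫ ω, X 0 ω ∂P < a) :
    ∀ᵐ ω ∂P, BddAbove (Set.range fun k => claimWalk X a k ω) := by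
  have hsl := strong_law_ae_real X hint (fun i j hij => hind.indepFun hij) hid
  filter_upwards [hsl] with ω hω
  have hev : ∀ᶠ k : ℕ in atTop, claimWalk X a k ω ≤ 0 := by
    filter_upwards [hω.eventually_lt_const ha, eventually_gt_atTop 0] with k hk hk0
    have hk0' : (0 : ℝ) < k := by exact_mod_cast hk0
    rw [div_lt_iff₀ hk0'] at hk
    unfold claimWalk
    linarith
  exact (isBoundedUnder_of_eventually_le hev).bddAbove_range

/-- Integrated form of the renewal equation: the mean of the integral of the tail function over the
step of the surplus vanishes. -/
lemma integral_intervalIntegral_supTail (hX : ∀ i, Measurable (X i)) (hind : iIndepFun X P)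
    (hid : ∀ i, IdentDistrib (X i) (X 0) P P) (hint : Integrable (X 0) P) {a : ℝ}
    (ha : ∫ ω, X 0 ω ∂P < a) {U : ℝ} (hU : 0 ≤ U) :
    ∫ ω, (∫ u in U..U + (a - X 0 ω), supTail P (claimWalk X a) u) ∂P = 0 := by
  set φ := supTail P (claimWalk X a)
  have hanti : Antitone φ := antitone_supTail
  have h0 : ∀ u, 0 ≤ φ u := supTail_nonneg
  have h1 : ∀ u, φ u ≤ 1 := supTail_le_one
  have hint' : ∀ V, Integrable (fun ω => ∫ u in V..V + (a - X 0 ω), φ u) P := by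
    intro V
    refine Integrable.mono' ((integrable_const a).sub hint).abs
      ((continuous_intervalIntegral_add hanti V).measurable.comp
        (measurable_const.sub (hX 0))).aestronglyMeasurable (ae_of_all _ fun ω => ?_)
    refine (abs_intervalIntegral_le h0 h1 _ _).trans ?_
    simp
  -- The mean does not depend on the base level: the difference between levels `U` and `V` is the
  -- renewal equation integrated over `[U, V]`.
  have hconst : ∀ V, U ≤ V → ∫ ω, (∫ u in U..U + (a - X 0 ω), φ u) ∂P =
      ∫ ω, (∫ u in V..V + (a - X 0 ω), φ u) ∂P := by
    intro V hV
    have hswap : ∫ u in U..V, φ u = ∫ ω, (∫ u in U..V, φ (u + (a - X 0 ω))) ∂P := by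
      rw [← intervalIntegral_integral_swap]
      · refine intervalIntegral.integral_congr fun u hu => ?_
        rw [Set.uIcc_of_le hV] at hu
        simp only [φ]
        rw [supTail_claimWalk_eq hX hind hid a (hU.trans hu.1)]
        simp only [add_sub_assoc]
      · have : IsFiniteMeasure (volume.restrict (Set.uIoc U V)) := by
          rw [Set.uIoc_of_le hV]; infer_instance
        refine Integrable.mono' (integrable_const (1 : ℝ)) ?_ (ae_of_all _ fun p => ?_)
        · refine (hanti.measurable.comp ?_).aestronglyMeasurable
          exact measurable_fst.add (measurable_const.sub ((hX 0).comp measurable_snd))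
        · simp only [Function.uncurry]
          rw [Real.norm_of_nonneg (h0 _)]
          exact h1 _
    have hpt : ∀ ω, (∫ u in U..U + (a - X 0 ω), φ u) - (∫ u in V..V + (a - X 0 ω), φ u) =
        (∫ u in U..V, φ u) - ∫ u in U..V, φ (u + (a - X 0 ω)) := by
      intro ω
      have hi : ∀ x y, IntervalIntegrable φ volume x y := fun _ _ => hanti.intervalIntegrable
      rw [intervalIntegral.integral_comp_add_right,
        ← intervalIntegral.integral_add_adjacent_intervals (hi U V) (hi V (U + (a - X 0 ω))),
        ← intervalIntegral.integral_add_adjacent_intervals (hi V (U + (a - X 0 ω)))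
          (hi (U + (a - X 0 ω)) (V + (a - X 0 ω)))]
      ring
    have hint2 : Integrable (fun ω => ∫ u in U..V, φ (u + (a - X 0 ω))) P := by
      have : (fun ω => ∫ u in U..V, φ (u + (a - X 0 ω))) = fun ω => (∫ u in U..V, φ u) -
          ((∫ u in U..U + (a - X 0 ω), φ u) - (∫ u in V..V + (a - X 0 ω), φ u)) := by
        funext ω; rw [hpt]; ring
      rw [this]
      exact (integrable_const _).sub ((hint' U).sub (hint' V))
    rw [← sub_eq_zero, ← integral_sub (hint' U) (hint' V)]
    simp_rw [hpt]
    rw [integral_sub (integrable_const _) hint2, ← hswap]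
    simp
  -- Sending the base level to infinity makes the mean vanish, since the tail tends to `0`; `|a - X
  -- 0|` dominates.
  have hlim : Tendsto (fun k : ℕ => ∫ ω, (∫ u in (U + k)..(U + k) + (a - X 0 ω), φ u) ∂P) atTop
      (nhds (∫ _, (0 : ℝ) ∂P)) := by
    refine tendsto_integral_of_dominated_convergence (fun ω => |a - X 0 ω|)
      (fun k => (hint' _).aestronglyMeasurable) ((integrable_const a).sub hint).abs
      (fun k => ae_of_all _ fun ω => ?_) (ae_of_all _ fun ω => ?_)
    · refine (abs_intervalIntegral_le h0 h1 _ _).trans ?_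
      simp
    · have hφ : Tendsto φ atTop (nhds 0) := tendsto_supTail_atTop (measurable_claimWalk hX a)
        (bddAbove_claimWalk hind hid hint ha)
      have hshift : Tendsto (fun k : ℕ => φ (U + k - |a - X 0 ω|) * |a - X 0 ω|) atTop
          (nhds (0 * |a - X 0 ω|)) := by
        refine (hφ.comp ?_).mul_const _
        exact tendsto_atTop_add_const_right _ _
          (tendsto_atTop_add_const_left _ _ tendsto_natCast_atTop_atTop)
      rw [zero_mul] at hshift
      refine squeeze_zero_norm (fun k => ?_) hshift
      -- The whole interval lies above `U + k - |a - X 0 ω|`, so the antitone tail is bounded by its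
      -- value there.
      have := intervalIntegral.norm_integral_le_of_norm_le_const (a := U + k)
        (b := U + k + (a - X 0 ω)) (C := φ (U + k - |a - X 0 ω|)) (f := φ) fun u hu => by
          rw [Real.norm_of_nonneg (h0 u)]
          refine hanti ?_
          have := hu.1.le
          have h3 := neg_abs_le (a - X 0 ω)
          have h4 := abs_nonneg (a - X 0 ω)
          rcases min_choice (U + k : ℝ) (U + k + (a - X 0 ω)) with h | h <;> rw [h] at this <;>
            linarith
      simpa using this
  rw [integral_zero] at hlim
  refine tendsto_nhds_unique (tendsto_const_nhds.congr fun k => ?_) hlim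
  exact hconst _ (by simp)

/-- The integrated renewal equation for non-negative claims, in the form of an integral over the
claim. -/
lemma intervalIntegral_supTail_eq (hX : ∀ i, Measurable (X i)) (hind : iIndepFun X P)
    (hid : ∀ i, IdentDistrib (X i) (X 0) P P) (hint : Integrable (X 0) P) {a : ℝ}
    (ha : ∫ ω, X 0 ω ∂P < a) {U : ℝ} (hU : 0 ≤ U) :
    ∫ u in U..U + a, supTail P (claimWalk X a) u =
      ∫ ω, (∫ x in (0 : ℝ)..X 0 ω, supTail P (claimWalk X a) (U + a - x)) ∂P := by
  have h := integral_intervalIntegral_supTail hX hind hid hint ha hU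
  set φ := supTail P (claimWalk X a)
  have hanti : Antitone φ := antitone_supTail
  have hi : ∀ x y, IntervalIntegrable φ volume x y := fun _ _ => hanti.intervalIntegrable
  have hpt : ∀ ω, ∫ u in U..U + (a - X 0 ω), φ u =
      (∫ u in U..U + a, φ u) - ∫ x in (0 : ℝ)..X 0 ω, φ (U + a - x) := by
    intro ω
    rw [intervalIntegral.integral_comp_sub_left, sub_zero,
      ← intervalIntegral.integral_add_adjacent_intervals (hi U (U + a - X 0 ω)) (hi _ (U + a)),
      add_sub_assoc U]
    ring
  have hint2 : Integrable (fun ω => ∫ x in (0 : ℝ)..X 0 ω, φ (U + a - x)) P := by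
    have hc : Continuous fun d => ∫ x in (0 : ℝ)..d, φ (U + a - x) :=
      intervalIntegral.continuous_primitive (fun _ _ => Monotone.intervalIntegrable
        fun x y hxy => hanti (by linarith)) 0
    refine Integrable.mono' hint.abs (hc.measurable.comp (hX 0)).aestronglyMeasurable
      (ae_of_all _ fun ω => ?_)
    refine (abs_intervalIntegral_le (fun u => supTail_nonneg _) (fun u => supTail_le_one _)
      _ _).trans ?_
    simp
  simp_rw [hpt] at h
  rw [integral_sub (integrable_const _) hint2] at h
  rw [integral_const, probReal_univ, one_smul] at h
  linarith

end Walk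

/-! ### Independence of regrouped families and of blocks. -/

section Curry

/-- If the random variables `X i j` indexed by pairs are independent, then so are the families
`(X i j)_j` indexed by `i`. -/
lemma iIndepFun_curry {P : Measure Ω} {ι : Type*} {κ : ι → Type*} {𝓧 : (i : ι) → κ i → Type*}
    [∀ i j, MeasurableSpace (𝓧 i j)] {X : (i : ι) → (j : κ i) → Ω → 𝓧 i j}
    (mX : ∀ i j, Measurable (X i j))
    (h : iIndepFun (fun (p : (i : ι) × κ i) ω => X p.1 p.2 ω) P) :
    iIndepFun (fun i ω j => X i j ω) P := by
  have := h.isProbabilityMeasure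
  have : ∀ i j, IsProbabilityMeasure (P.map (X i j)) :=
    fun i j => Measure.isProbabilityMeasure_map (mX i j).aemeasurable
  have hrow : ∀ i, P.map (fun ω j => X i j ω) = Measure.infinitePi fun j => P.map (X i j) := by
    intro i
    exact (iIndepFun_iff_map_fun_eq_infinitePi_map (mX i)).1
      (h.precomp (g := fun j => (⟨i, j⟩ : (i : ι) × κ i)) sigma_mk_injective)
  rw [iIndepFun_iff_map_fun_eq_infinitePi_map fun i => measurable_pi_lambda _ (mX i)]
  simp_rw [hrow]
  rw [← Measure.infinitePi_map_piCurry (fun i j => P.map (X i j)),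
    ← (iIndepFun_iff_map_fun_eq_infinitePi_map (fun p : (i : ι) × κ i => mX p.1 p.2)).1 h,
    Measure.map_map (by fun_prop) (measurable_pi_lambda _ fun p => mX p.1 p.2)]
  rfl

end Curry

section Blocks

variable {P : Measure Ω} {Y : ℕ → Ω → ℝ}

lemma identDistrib_sum_shift (hind : iIndepFun Y P)
    (hid : ∀ k, IdentDistrib (Y k) (Y 0) P P) (a d : ℕ) :
    IdentDistrib (fun ω => ∑ l : Fin d, Y (a + l) ω) (fun ω => ∑ l ∈ Finset.range d, Y l ω) P P := by
  have h : IdentDistrib (fun ω l => Y (a + l) ω) (fun ω l => Y l ω) P P :=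
    IdentDistrib.pi (fun i => (hid (a + i)).trans (hid i).symm)
      (hind.precomp (add_right_injective a)) hind
  have := h.comp (u := fun y => ∑ l : Fin d, y l) (by fun_prop)
  simpa [Function.comp_def, Finset.sum_range] using this

/-- Sums of independent identically distributed variables over consecutive blocks are
independent, and their laws depend only on the lengths of the blocks. -/
lemma measure_blocks (hY : ∀ k, Measurable (Y k)) (hind : iIndepFun Y P)
    (hid : ∀ k, IdentDistrib (Y k) (Y 0) P P) {n : ℕ → ℕ} (hn : Monotone n) (s : Finset ℕ)
    {B : ℕ → Set ℝ} (hB : ∀ k, MeasurableSet (B k)) :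
    P {ω | ∀ k ∈ s, ∑ i ∈ Finset.Ico (n k) (n (k + 1)), Y i ω ∈ B k} =
      ∏ k ∈ s, P {ω | ∑ i ∈ Finset.range (n (k + 1) - n k), Y i ω ∈ B k} := by
  -- Positions inside the `k`-th block. The blocks are disjoint, so the map sending a pair (block,
  -- position) to a claim index is injective and independence can be regrouped by blocks.
  let κ : ℕ → Type := fun k => Fin (n (k + 1) - n k)
  have hlt : ∀ (k l : ℕ) (a : κ k) (b : κ l), k < l → n k + a.1 < n l + b.1 := by
    intro k l a b h
    have h1 := hn (show k + 1 ≤ l from h)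
    have h2 := a.2
    omega
  have hinj : Function.Injective fun p : (k : ℕ) × κ k => n p.1 + p.2.1 := by
    rintro ⟨k, a⟩ ⟨l, b⟩ h
    simp only at h
    rcases lt_trichotomy k l with hkl | rfl | hkl
    · have := hlt k l a b hkl; omega
    · have : a = b := Fin.ext (by omega)
      rw [this]
    · have := hlt l k b a hkl; omega
  have h1 := iIndepFun_curry (X := fun k (l : κ k) => Y (n k + l.1)) (fun k l => hY _)
    (hind.precomp hinj)
  have h2 := h1.comp (fun k (y : κ k → ℝ) => ∑ l, y l) (fun k => by fun_prop)
  have h3 := h2.measure_inter_preimage_eq_mul s (sets := B) fun k _ => hB k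
  convert! h3 using 1
  · congr 1
    ext ω
    simp only [Set.mem_ofPred_eq, Set.mem_iInter, Set.mem_preimage, Function.comp]
    refine forall₂_congr fun k _ => ?_
    rw [Finset.sum_Ico_eq_sum_range, Finset.sum_range]
  · refine Finset.prod_congr rfl fun k _ => ?_
    exact ((identDistrib_sum_shift hind hid (n k) (n (k + 1) - n k)).measure_mem_eq (hB k)).symm

end Blocks

/-! ### Increments of a compound Poisson process. -/

section Increments

variable {P : Measure Ω} {lam : ℝ≥0} {N : ℝ≥0 → Ω → ℕ} {Y : ℕ → Ω → ℝ}

lemma measurable_claimTotal (hN : ∀ t, Measurable (N t)) (hY : ∀ k, Measurable (Y k)) (t : ℝ≥0) :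
    Measurable (claimTotal N Y t) := by
  have h : Measurable fun p : Ω × ℕ => ∑ k ∈ Finset.range p.2, Y k p.1 :=
    measurable_from_prod_countable_left fun n => by
      change Measurable fun x => ∑ k ∈ Finset.range n, Y k x
      fun_prop
  exact h.comp (measurable_id.prodMk (hN t))

lemma claimTotal_sub_eq {s t : ℝ≥0} {ω : Ω} (h : N s ω ≤ N t ω) :
    claimTotal N Y t ω - claimTotal N Y s ω = ∑ i ∈ Finset.Ico (N s ω) (N t ω), Y i ω :=
  (Finset.sum_Ico_eq_sub _ h).symm

/-- The joint law of the increments of a compound Poisson process. -/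
lemma measure_claimIncrements [IsProbabilityMeasure P] (hN : IsPoissonProcess lam N P)
    (hY : ∀ k, Measurable (Y k)) (hind : iIndepFun Y P)
    (hid : ∀ k, IdentDistrib (Y k) (Y 0) P P)
    (hYN : IndepFun (fun ω k => Y k ω) (fun ω t => N t ω) P)
    {t : ℕ → ℝ≥0} (ht : Monotone t) (s : Finset ℕ) {B : ℕ → Set ℝ}
    (hB : ∀ k, MeasurableSet (B k)) :
    P (⋂ k ∈ s, (fun ω => claimTotal N Y (t (k + 1)) ω - claimTotal N Y (t k) ω) ⁻¹' B k) =
      ∏ k ∈ s, ∫⁻ m, P {ω | ∑ i ∈ Finset.range m, Y i ω ∈ B k}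
        ∂poissonMeasure (lam * (t (k + 1) - t k)) := by
  let E : Set ((ℕ → ℝ) × (ℕ → ℕ)) :=
    {p | ∀ k ∈ s, ∑ i ∈ Finset.Ico (p.2 k) (p.2 (k + 1)), p.1 i ∈ B k}
  have hE : MeasurableSet E := by
    have : E = ⋂ k ∈ s, {p | ∑ i ∈ Finset.Ico (p.2 k) (p.2 (k + 1)), p.1 i ∈ B k} := by
      ext p; simp [E]
    rw [this]
    refine Finset.measurableSet_biInter _ fun k _ => ?_
    have hm : Measurable fun q : (ℕ → ℝ) × (ℕ × ℕ) => ∑ i ∈ Finset.Ico q.2.1 q.2.2, q.1 i :=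
      measurable_from_prod_countable_left fun c => by
        change Measurable fun y : ℕ → ℝ => ∑ i ∈ Finset.Ico c.1 c.2, y i
        fun_prop
    have hf : Measurable fun p : (ℕ → ℝ) × (ℕ → ℕ) => (p.1, (p.2 k, p.2 (k + 1))) := by fun_prop
    exact (hm.comp hf) (hB k)
  have hmY : Measurable fun ω k => Y k ω := measurable_pi_lambda _ hY
  have hmN : Measurable fun ω k => N (t k) ω := measurable_pi_lambda _ fun k => hN.measurable _
  have hlaw := (indepFun_iff_map_prod_eq_prod_map_map hmY.aemeasurable hmN.aemeasurable).1
    (hYN.comp (φ := fun y => y) (ψ := fun (f : ℝ≥0 → ℕ) (k : ℕ) => f (t k)) measurable_id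
      (by fun_prop))
  have hset : (⋂ k ∈ s, (fun ω => claimTotal N Y (t (k + 1)) ω - claimTotal N Y (t k) ω) ⁻¹' B k)
      =ᵐ[P] (fun ω => ((fun k => Y k ω), fun k => N (t k) ω)) ⁻¹' E := by
    filter_upwards [hN.monotone_paths] with ω hω
    apply propext
    change ω ∈ (⋂ k ∈ s, _) ↔ ∀ k ∈ s, _
    simp only [Set.mem_iInter, Set.mem_preimage]
    refine forall₂_congr fun k _ => ?_
    rw [claimTotal_sub_eq (hω (ht k.le_succ))]
  rw [measure_congr hset, ← Measure.map_apply (hmY.prodMk hmN) hE, hlaw,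
    Measure.prod_apply_symm hE, lintegral_map (measurable_measure_prodMk_right hE) hmN]
  let q : ℕ → ℕ → ℝ≥0∞ := fun k m => P {ω | ∑ i ∈ Finset.range m, Y i ω ∈ B k}
  -- With the counts frozen, the increments are sums over consecutive blocks of claims, so their
  -- joint probability factorises in the count increments.
  have hsec : ∀ᵐ ω ∂P, (P.map fun ω k => Y k ω) ((fun y => (y, fun k => N (t k) ω)) ⁻¹' E) =
      ∏ k ∈ s, q k (N (t (k + 1)) ω - N (t k) ω) := by
    filter_upwards [hN.monotone_paths] with ω hω
    rw [Measure.map_apply hmY (hE.preimage (by fun_prop))]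
    exact measure_blocks hY hind hid (n := fun k => N (t k) ω) (fun _ _ h => hω (ht h)) s hB
  rw [lintegral_congr_ae hsec]
  have hMind : iIndepFun (fun k ω => q k (N (t (k + 1)) ω - N (t k) ω)) P :=
    (hN.indep_increments.nat ht).comp q fun k => .of_discrete
  have hMm : ∀ k, Measurable fun ω => N (t (k + 1)) ω - N (t k) ω := fun k =>
    (hN.measurable _).sub (hN.measurable _)
  rw [lintegral_prod_eq_prod_lintegral_of_indepFun s _ hMind
    fun k => (Measurable.of_discrete (f := q k)).comp (hMm k)]
  refine Finset.prod_congr rfl fun k _ => ?_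
  rw [← (hN.law_increments (t k) (t (k + 1)) (ht k.le_succ)).map_eq,
    lintegral_map .of_discrete (hMm k)]

variable [IsProbabilityMeasure P]

lemma measure_claimIncrement
    (hN : IsPoissonProcess lam N P) (hY : ∀ k, Measurable (Y k)) (hind : iIndepFun Y P)
    (hid : ∀ k, IdentDistrib (Y k) (Y 0) P P)
    (hYN : IndepFun (fun ω k => Y k ω) (fun ω t => N t ω) P) {t : ℕ → ℝ≥0} (ht : Monotone t)
    (k : ℕ) {B : Set ℝ} (hB : MeasurableSet B) :
    P ((fun ω => claimTotal N Y (t (k + 1)) ω - claimTotal N Y (t k) ω) ⁻¹' B) =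
      ∫⁻ m, P {ω | ∑ i ∈ Finset.range m, Y i ω ∈ B}
        ∂poissonMeasure (lam * (t (k + 1) - t k)) := by
  simpa using measure_claimIncrements hN hY hind hid hYN ht {k} (B := fun _ => B) fun _ => hB

lemma iIndepFun_claimIncrements
    (hN : IsPoissonProcess lam N P) (hY : ∀ k, Measurable (Y k)) (hind : iIndepFun Y P)
    (hid : ∀ k, IdentDistrib (Y k) (Y 0) P P)
    (hYN : IndepFun (fun ω k => Y k ω) (fun ω t => N t ω) P) {t : ℕ → ℝ≥0} (ht : Monotone t) :
    iIndepFun (fun k ω => claimTotal N Y (t (k + 1)) ω - claimTotal N Y (t k) ω) P := by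
  rw [iIndepFun_iff_measure_inter_preimage_eq_mul]
  intro s B hB
  classical
  have h := measure_claimIncrements hN hY hind hid hYN ht s
    -- Measurability is known only for indices in `s`; elsewhere the set plays no role and is
    -- replaced by `∅`.
    (B := fun k => if k ∈ s then B k else ∅)
    fun k => by split_ifs with hk; exacts [hB k hk, .empty]
  have h2 : (⋂ k ∈ s, (fun ω => claimTotal N Y (t (k + 1)) ω - claimTotal N Y (t k) ω) ⁻¹'
      (if k ∈ s then B k else ∅)) =
      ⋂ k ∈ s, (fun ω => claimTotal N Y (t (k + 1)) ω - claimTotal N Y (t k) ω) ⁻¹' B k :=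
    Set.iInter₂_congr fun k hk => by rw [if_pos hk]
  rw [← h2, h]
  refine Finset.prod_congr rfl fun k hk => ?_
  rw [if_pos hk, measure_claimIncrement hN hY hind hid hYN ht k (hB k hk)]

lemma identDistrib_claimIncrements
    (hN : IsPoissonProcess lam N P) (hY : ∀ k, Measurable (Y k)) (hind : iIndepFun Y P)
    (hid : ∀ k, IdentDistrib (Y k) (Y 0) P P)
    (hYN : IndepFun (fun ω k => Y k ω) (fun ω t => N t ω) P) {t : ℕ → ℝ≥0} (ht : Monotone t)
    (k : ℕ) (hk : t (k + 1) - t k = t 1 - t 0) :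
    IdentDistrib (fun ω => claimTotal N Y (t (k + 1)) ω - claimTotal N Y (t k) ω)
      (fun ω => claimTotal N Y (t 1) ω - claimTotal N Y (t 0) ω) P P := by
  have hm : ∀ k, Measurable fun ω => claimTotal N Y (t (k + 1)) ω - claimTotal N Y (t k) ω :=
    fun k => (measurable_claimTotal hN.measurable hY _).sub
      (measurable_claimTotal hN.measurable hY _)
  refine ⟨(hm k).aemeasurable, (hm 0).aemeasurable, Measure.ext fun B hB => ?_⟩
  rw [Measure.map_apply (hm k) hB, measure_claimIncrement hN hY hind hid hYN ht k hB,
    Measure.map_apply (hm 0) hB, measure_claimIncrement hN hY hind hid hYN ht 0 hB, hk]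

end Increments

/-! ### Poisson estimates and short-time expansions for one participant. -/

section Poisson

lemma lintegral_natCast_poissonMeasure (r : ℝ≥0) :
    ∫⁻ m, (m : ℝ≥0∞) ∂poissonMeasure r = r := by
  -- The mean comes from shifting the index: `(m + 1) p_{m+1} = r p_m`.
  have hterm : ∀ m : ℕ, poissonMeasure r {m + 1} * ((m + 1 : ℕ) : ℝ≥0∞) =
      r * poissonMeasure r {m} := by
    intro m
    have hr : (r : ℝ≥0∞) = ENNReal.ofReal r := (ENNReal.ofReal_coe_nnreal).symm
    rw [poissonMeasure_singleton, poissonMeasure_singleton, ← ENNReal.ofReal_natCast, hr,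
      ← ENNReal.ofReal_mul (by positivity), ← ENNReal.ofReal_mul (by positivity)]
    congr 1
    rw [Nat.factorial_succ]
    push_cast
    field_simp
    ring
  rw [lintegral_countable', tsum_eq_zero_add' ENNReal.summable]
  simp_rw [mul_comm ((_ : ℕ) : ℝ≥0∞), hterm]
  rw [ENNReal.tsum_mul_left]
  have : ∑' m, poissonMeasure r {m} = 1 := by
    have := lintegral_countable' (μ := poissonMeasure r) fun _ => 1
    simpa using this.symm
  simp [this]

end Poisson

section Single

variable {P : Measure Ω} [IsProbabilityMeasure P] {lam : ℝ≥0} {N : ℝ≥0 → Ω → ℕ}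
  {Y : ℕ → Ω → ℝ}

lemma hasLaw_poisson (hN : IsPoissonProcess lam N P) (t : ℝ≥0) :
    HasLaw (N t) (poissonMeasure (lam * t)) P := by
  have h := hN.law_increments 0 t zero_le
  rw [tsub_zero] at h
  refine h.congr ?_
  filter_upwards [hN.zero] with ω hω
  simp [hω]

lemma hasLaw_poisson_real_singleton {M : Ω → ℕ} {r : ℝ≥0} (hm : Measurable M)
    (hM : HasLaw M (poissonMeasure r) P) (k : ℕ) :
    P.real {ω | M ω = k} = Real.exp (-r) * r ^ k / k.factorial := by
  have h1 : P.real {ω | M ω = k} = (P.map M).real {k} := by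
    rw [map_measureReal_apply hm (measurableSet_singleton _)]
    rfl
  rw [h1, hM.map_eq, poissonMeasure_real_singleton]

lemma hasLaw_poisson_ne_zero_le {M : Ω → ℕ} {r : ℝ≥0} (hm : Measurable M)
    (hM : HasLaw M (poissonMeasure r) P) : P.real {ω | M ω ≠ 0} ≤ r := by
  have hm0 : MeasurableSet {ω | M ω = 0} := hm (measurableSet_singleton 0)
  have h2 : P.real {ω | M ω ≠ 0} = 1 - P.real {ω | M ω = 0} := by
    rw [← probReal_compl_eq_one_sub hm0]
    rfl
  rw [h2, hasLaw_poisson_real_singleton hm hM]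
  have := Real.add_one_le_exp (-(r : ℝ))
  simp
  linarith

/-- `1 - e^{-r} (1 + r) ≤ 1 - (1 - r) (1 + r) = r ^ 2`. -/
lemma hasLaw_poisson_two_le {M : Ω → ℕ} {r : ℝ≥0} (hm : Measurable M)
    (hM : HasLaw M (poissonMeasure r) P) : P.real {ω | 2 ≤ M ω} ≤ (r : ℝ) ^ 2 := by
  have hmk : ∀ k, MeasurableSet {ω | M ω = k} := fun k => hm (measurableSet_singleton k)
  have hcompl : {ω | 2 ≤ M ω} = ({ω | M ω = 0} ∪ {ω | M ω = 1})ᶜ := by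
    ext ω; simp; omega
  rw [hcompl, probReal_compl_eq_one_sub ((hmk 0).union (hmk 1)), measureReal_union _ (hmk 1),
    hasLaw_poisson_real_singleton hm hM, hasLaw_poisson_real_singleton hm hM]
  · have h1 := Real.add_one_le_exp (-(r : ℝ))
    have h2 : (0 : ℝ) ≤ r := r.2
    simp only [pow_zero, Nat.factorial_zero, Nat.cast_one, pow_one, Nat.factorial_one, mul_one,
      div_one]
    nlinarith
  · rw [Set.disjoint_left]
    intro ω h1 h2
    simp only [Set.mem_ofPred_eq] at h1 h2
    omega

/-- Wald's identity for non-negative functions of the claims. -/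
lemma lintegral_sum_claims
    (hN : IsPoissonProcess lam N P) (hY : ∀ k, Measurable (Y k))
    (hid : ∀ k, IdentDistrib (Y k) (Y 0) P P)
    (hYN : IndepFun (fun ω k => Y k ω) (fun ω t => N t ω) P)
    (t : ℝ≥0) {f : ℝ → ℝ≥0∞} (hf : Measurable f) :
    ∫⁻ ω, ∑ k ∈ Finset.range (N t ω), f (Y k ω) ∂P =
      ((lam * t : ℝ≥0) : ℝ≥0∞) * ∫⁻ ω, f (Y 0 ω) ∂P := by
  -- The random sum becomes a series weighted by the indicators of `k < N t`, which are independent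
  -- of the claims.
  let v : ℕ → ℕ → ℝ≥0∞ := fun k m => if k < m then 1 else 0
  have hsum : ∀ (m : ℕ) (c : ℕ → ℝ≥0∞), ∑ k ∈ Finset.range m, c k = ∑' k, v k m * c k := by
    intro m c
    rw [tsum_eq_sum (s := Finset.range m)]
    · exact Finset.sum_congr rfl fun k hk => by simp [v, Finset.mem_range.1 hk]
    · intro k hk
      simp only [Finset.mem_range] at hk
      simp [v, hk]
  have hvm : ∀ k, Measurable fun ω => v k (N t ω) := fun k =>
    (Measurable.of_discrete (f := v k)).comp (hN.measurable t)
  have hfm : ∀ k, Measurable fun ω => f (Y k ω) := fun k => hf.comp (hY k)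
  simp_rw [hsum]
  rw [lintegral_tsum (f := fun k ω => v k (N t ω) * f (Y k ω))
    fun k => ((hvm k).mul (hfm k)).aemeasurable]
  have hterm : ∀ k, ∫⁻ ω, v k (N t ω) * f (Y k ω) ∂P =
      (∫⁻ ω, v k (N t ω) ∂P) * ∫⁻ ω, f (Y 0 ω) ∂P := by
    intro k
    have hind : IndepFun (fun ω => v k (N t ω)) (fun ω => f (Y k ω)) P :=
      hYN.symm.comp (φ := fun x : ℝ≥0 → ℕ => v k (x t)) (ψ := fun y : ℕ → ℝ => f (y k))
        ((Measurable.of_discrete (f := v k)).comp (measurable_pi_apply t))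
        (hf.comp (measurable_pi_apply k))
    have := lintegral_mul_eq_lintegral_mul_lintegral_of_indepFun (hvm k) (hfm k) hind
    simp only [Pi.mul_apply] at this
    rw [this]
    congr 1
    exact ((hid k).comp hf).lintegral_eq
  simp_rw [hterm]
  rw [ENNReal.tsum_mul_right, ← lintegral_tsum fun k => (hvm k).aemeasurable]
  congr 1
  have hcount : ∀ m : ℕ, ∑' k, v k m = m := by
    intro m
    have := hsum m fun _ => 1
    simpa using this.symm
  simp_rw [hcount]
  rw [← lintegral_natCast_poissonMeasure, ← (hasLaw_poisson hN t).map_eq,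
    lintegral_map .of_discrete (hN.measurable t)]

lemma claimTotal_nonneg
    (hY0 : ∀ k, ∀ᵐ ω ∂P, 0 ≤ Y k ω) :
    ∀ᵐ ω ∂P, ∀ t, 0 ≤ claimTotal N Y t ω := by
  filter_upwards [ae_all_iff.2 hY0] with ω hω t
  exact Finset.sum_nonneg fun k _ => hω k

lemma lintegral_claimTotal
    (hN : IsPoissonProcess lam N P) (hY : ∀ k, Measurable (Y k)) (hY0 : ∀ k, ∀ᵐ ω ∂P, 0 ≤ Y k ω)
    (hid : ∀ k, IdentDistrib (Y k) (Y 0) P P)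
    (hYN : IndepFun (fun ω k => Y k ω) (fun ω t => N t ω) P)
    (t : ℝ≥0) :
    ∫⁻ ω, ENNReal.ofReal (claimTotal N Y t ω) ∂P =
      ((lam * t : ℝ≥0) : ℝ≥0∞) * ∫⁻ ω, ENNReal.ofReal (Y 0 ω) ∂P := by
  rw [← lintegral_sum_claims hN hY hid hYN t ENNReal.measurable_ofReal]
  refine lintegral_congr_ae ?_
  filter_upwards [ae_all_iff.2 hY0] with ω hω
  exact ENNReal.ofReal_sum_of_nonneg fun k _ => hω k

lemma integrable_claimTotal
    (hN : IsPoissonProcess lam N P) (hY : ∀ k, Measurable (Y k)) (hY0 : ∀ k, ∀ᵐ ω ∂P, 0 ≤ Y k ω)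
    (hYint : Integrable (Y 0) P) (hid : ∀ k, IdentDistrib (Y k) (Y 0) P P)
    (hYN : IndepFun (fun ω k => Y k ω) (fun ω t => N t ω) P)
    (t : ℝ≥0) : Integrable (claimTotal N Y t) P := by
  have hm := measurable_claimTotal hN.measurable hY t
  have h0 : 0 ≤ᵐ[P] claimTotal N Y t := (claimTotal_nonneg hY0).mono fun ω h => h t
  refine ⟨hm.aestronglyMeasurable, ?_⟩
  rw [hasFiniteIntegral_iff_ofReal h0, lintegral_claimTotal hN hY hY0 hid hYN]
  refine ENNReal.mul_lt_top ENNReal.coe_lt_top ?_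
  rw [← hasFiniteIntegral_iff_ofReal (hY0 0)]
  exact hYint.2

lemma integral_claimTotal
    (hN : IsPoissonProcess lam N P) (hY : ∀ k, Measurable (Y k)) (hY0 : ∀ k, ∀ᵐ ω ∂P, 0 ≤ Y k ω)
    (hYint : Integrable (Y 0) P) (hid : ∀ k, IdentDistrib (Y k) (Y 0) P P)
    (hYN : IndepFun (fun ω k => Y k ω) (fun ω t => N t ω) P)
    (t : ℝ≥0) :
    ∫ ω, claimTotal N Y t ω ∂P = lam * t * ∫ ω, Y 0 ω ∂P := by
  have hm := measurable_claimTotal hN.measurable hY t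
  have h0 : 0 ≤ᵐ[P] claimTotal N Y t := (claimTotal_nonneg hY0).mono fun ω h => h t
  rw [integral_eq_lintegral_of_nonneg_ae h0 hm.aestronglyMeasurable,
    lintegral_claimTotal hN hY hY0 hid hYN,
    integral_eq_lintegral_of_nonneg_ae (hY0 0) hYint.aestronglyMeasurable, ENNReal.toReal_mul]
  simp

lemma integral_indicator_one_claim
    (hN : IsPoissonProcess lam N P) (hY : ∀ k, Measurable (Y k))
    (hYN : IndepFun (fun ω k => Y k ω) (fun ω t => N t ω) P)
    (t : ℝ≥0) {g : ℝ → ℝ} (hg : Measurable g) :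
    ∫ ω, {ω | N t ω = 1}.indicator (fun ω => g (Y 0 ω)) ω ∂P =
      Real.exp (-(lam * t)) * (lam * t) * ∫ ω, g (Y 0 ω) ∂P := by
  have hm1 : MeasurableSet {ω | N t ω = 1} := hN.measurable t (measurableSet_singleton 1)
  let v : ℕ → ℝ := fun m => if m = 1 then 1 else 0
  have hind : IndepFun (fun ω => v (N t ω)) (fun ω => g (Y 0 ω)) P :=
    hYN.symm.comp (φ := fun x : ℝ≥0 → ℕ => v (x t)) (ψ := fun y : ℕ → ℝ => g (y 0))
      ((Measurable.of_discrete (f := v)).comp (measurable_pi_apply t))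
      (hg.comp (measurable_pi_apply 0))
  have h1 : ∀ ω, {ω | N t ω = 1}.indicator (fun ω => g (Y 0 ω)) ω = v (N t ω) * g (Y 0 ω) := by
    intro ω
    by_cases h : N t ω = 1 <;> simp [v, h]
  have h2 : ∀ ω, v (N t ω) = {ω | N t ω = 1}.indicator 1 ω := by
    intro ω
    by_cases h : N t ω = 1 <;> simp [v, h]
  simp_rw [h1]
  rw [hind.integral_fun_mul_eq_mul_integral
    ((Measurable.of_discrete (f := v)).comp (hN.measurable t)).aestronglyMeasurable
    (hg.comp (hY 0)).aestronglyMeasurable]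
  simp_rw [h2]
  rw [integral_indicator_one hm1,
    hasLaw_poisson_real_singleton (hN.measurable t) (hasLaw_poisson hN t)]
  simp

/-- A function of the claim amount lying between `0` and the identity on the positive half-line. -/
structure IsSublinear (g : ℝ → ℝ) : Prop where
  measurable : Measurable g
  zero : g 0 = 0
  nonneg : ∀ y, 0 ≤ y → 0 ≤ g y
  le_self : ∀ y, 0 ≤ y → g y ≤ y

lemma IsSublinear.integrable {g : ℝ → ℝ} (hg : IsSublinear g) {Z : Ω → ℝ}
    (hZ : Integrable Z P) (hm : Measurable Z) (h0 : ∀ᵐ ω ∂P, 0 ≤ Z ω) :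
    Integrable (fun ω => g (Z ω)) P := by
  refine Integrable.mono' hZ (hg.measurable.comp hm).aestronglyMeasurable ?_
  filter_upwards [h0] with ω hω
  rw [Real.norm_of_nonneg (hg.nonneg _ hω)]
  exact hg.le_self _ hω

/-- Keep only the event of exactly one claim; elsewhere the integrand is non-negative. -/
lemma integral_sublinear_ge
    (hN : IsPoissonProcess lam N P) (hY : ∀ k, Measurable (Y k)) (hY0 : ∀ k, ∀ᵐ ω ∂P, 0 ≤ Y k ω)
    (hYint : Integrable (Y 0) P) (hid : ∀ k, IdentDistrib (Y k) (Y 0) P P)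
    (hYN : IndepFun (fun ω k => Y k ω) (fun ω t => N t ω) P)
    (t : ℝ≥0) {g : ℝ → ℝ} (hg : IsSublinear g) :
    Real.exp (-(lam * t)) * (lam * t) * ∫ ω, g (Y 0 ω) ∂P ≤
      ∫ ω, g (claimTotal N Y t ω) ∂P := by
  have hm1 : MeasurableSet {ω | N t ω = 1} := hN.measurable t (measurableSet_singleton 1)
  rw [← integral_indicator_one_claim hN hY hYN t hg.measurable]
  refine integral_mono_ae ((hg.integrable hYint (hY 0) (hY0 0)).indicator hm1)
    (hg.integrable (integrable_claimTotal hN hY hY0 hYint hid hYN t)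
      (measurable_claimTotal hN.measurable hY t)
      ((claimTotal_nonneg hY0).mono fun ω h => h t)) ?_
  filter_upwards [claimTotal_nonneg (N := N) hY0] with ω hω
  by_cases h : N t ω = 1
  · simp [h, claimTotal]
  · simp [h, hg.nonneg _ (hω t)]

/-- On the event of exactly one claim the value is exact; off it, bound the function by the
identity. With `r = lam * t`, the mean claim total off that event is `r b (1 - e^{-r}) ≤ r b * r`,
of second order in time. -/
lemma integral_sublinear_le
    (hN : IsPoissonProcess lam N P) (hY : ∀ k, Measurable (Y k)) (hY0 : ∀ k, ∀ᵐ ω ∂P, 0 ≤ Y k ω)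
    (hYint : Integrable (Y 0) P) (hid : ∀ k, IdentDistrib (Y k) (Y 0) P P)
    (hYN : IndepFun (fun ω k => Y k ω) (fun ω t => N t ω) P)
    (t : ℝ≥0) {g : ℝ → ℝ} (hg : IsSublinear g) {w : ℝ} (hw : 0 ≤ w) :
    ∫ ω, g (w * claimTotal N Y t ω) ∂P ≤
      lam * t * ∫ ω, g (w * Y 0 ω) ∂P + w * (lam * t * ∫ ω, Y 0 ω ∂P) * (lam * t) := by
  have hm1 : MeasurableSet {ω | N t ω = 1} := hN.measurable t (measurableSet_singleton 1)
  have hSint := integrable_claimTotal hN hY hY0 hYint hid hYN t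
  have hSm := measurable_claimTotal hN.measurable hY t
  have hS0 := claimTotal_nonneg (N := N) hY0
  have hgY : Integrable (fun ω => g (w * Y 0 ω)) P :=
    hg.integrable (hYint.const_mul w) ((hY 0).const_mul w)
      ((hY0 0).mono fun ω h => mul_nonneg hw h)
  have hgS : Integrable (fun ω => g (w * claimTotal N Y t ω)) P :=
    hg.integrable (hSint.const_mul w) (hSm.const_mul w) (hS0.mono fun ω h => mul_nonneg hw (h t))
  have hI1 := hgY.indicator hm1
  have hI2 : Integrable (fun ω => {ω | N t ω = 1}.indicator (fun ω => Y 0 ω) ω) P :=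
    hYint.indicator hm1
  have hI3 : Integrable (fun ω => w *
      (claimTotal N Y t ω - {ω | N t ω = 1}.indicator (fun ω => Y 0 ω) ω)) P :=
    (hSint.sub hI2).const_mul w
  have hle : ∫ ω, g (w * claimTotal N Y t ω) ∂P ≤
      ∫ ω, ({ω | N t ω = 1}.indicator (fun ω => g (w * Y 0 ω)) ω +
        w * (claimTotal N Y t ω - {ω | N t ω = 1}.indicator (fun ω => Y 0 ω) ω)) ∂P := by
    refine integral_mono_ae hgS (hI1.add hI3) ?_
    filter_upwards [hS0] with ω hω
    by_cases h : N t ω = 1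
    · simp [h, claimTotal]
    · simpa [h] using hg.le_self _ (mul_nonneg hw (hω t))
  refine hle.trans ?_
  rw [integral_add hI1 hI3, integral_const_mul, integral_sub hSint hI2,
    integral_indicator_one_claim hN hY hYN t (g := fun y => g (w * y))
      (hg.measurable.comp (measurable_const_mul w)),
    integral_indicator_one_claim hN hY hYN t (g := fun y => y) measurable_id,
    integral_claimTotal hN hY hY0 hYint hid hYN]
  have hr : (0 : ℝ) ≤ lam * t := by positivity
  have hG : 0 ≤ ∫ ω, g (w * Y 0 ω) ∂P :=
    integral_nonneg_of_ae ((hY0 0).mono fun ω h => hg.nonneg _ (mul_nonneg hw h))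
  have hb : 0 ≤ ∫ ω, Y 0 ω ∂P := integral_nonneg_of_ae (hY0 0)
  have he1 : Real.exp (-(lam * t : ℝ)) ≤ 1 := Real.exp_le_one_iff.2 (by linarith)
  have he2 := Real.add_one_le_exp (-(lam * t : ℝ))
  set r : ℝ := lam * t
  set e := Real.exp (-r)
  have h1 : e * r * (∫ ω, g (w * Y 0 ω) ∂P) ≤ r * ∫ ω, g (w * Y 0 ω) ∂P := by
    have := mul_nonneg hr hG
    nlinarith
  have h2 : w * (r * (∫ ω, Y 0 ω ∂P) - e * r * ∫ ω, Y 0 ω ∂P) ≤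
      w * (r * ∫ ω, Y 0 ω ∂P) * r := by
    have := mul_nonneg hw (mul_nonneg hr hb)
    nlinarith
  linarith

lemma probReal_claimTotal_ne_zero_le
    (hN : IsPoissonProcess lam N P) (t : ℝ≥0) :
    P.real {ω | claimTotal N Y t ω ≠ 0} ≤ lam * t := by
  refine (measureReal_mono fun ω hω => ?_).trans
    ((hasLaw_poisson_ne_zero_le (hN.measurable t) (hasLaw_poisson hN t)).trans_eq (by simp))
  intro h
  exact hω (by simp [claimTotal, h])

end Single

/-! ### Dyadic grids and the shared claims of several participants. -/

lemma monotone_dyadicTime (m : ℕ) : Monotone (dyadicTime m) := fun k l h => by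
  unfold dyadicTime; gcongr

lemma dyadicTime_succ_sub (m k : ℕ) :
    dyadicTime m (k + 1) - dyadicTime m k = dyadicTime m 1 := by
  unfold dyadicTime
  rw [Nat.cast_add, add_div, add_tsub_cancel_left]

lemma dyadicTime_zero (m : ℕ) : dyadicTime m 0 = 0 := by simp [dyadicTime]

lemma tendsto_dyadicTime_one : Tendsto (fun m => (dyadicTime m 1 : ℝ)) atTop (nhds 0) := by
  have : ∀ m, (dyadicTime m 1 : ℝ) = (1 / 2) ^ m := fun m => by simp [dyadicTime]
  simp_rw [this]
  exact tendsto_pow_atTop_nhds_zero_of_lt_one (by norm_num) (by norm_num)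

lemma dyadicTime_one_pos (m : ℕ) : (0 : ℝ) < dyadicTime m 1 := by
  simp [dyadicTime]

lemma coe_dyadicTime (m k : ℕ) : (dyadicTime m k : ℝ) = k * dyadicTime m 1 := by
  simp [dyadicTime, div_eq_mul_inv]

/-- The cumulative amount `∑_j w_j S_{j,t}` borne by a party covering the proportion `w_j` of the
claims of participant `j`. -/
def sharedTotal {n : ℕ} (w : Fin n → ℝ) (N : Fin n → ℝ≥0 → Ω → ℕ) (Y : Fin n → ℕ → Ω → ℝ)
    (t : ℝ≥0) (ω : Ω) : ℝ :=
  ∑ j, w j * claimTotal (N j) (Y j) t ω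

/-- The increments of the shared cumulative claims over a dyadic grid. -/
def sharedIncrement {n : ℕ} (w : Fin n → ℝ) (N : Fin n → ℝ≥0 → Ω → ℕ) (Y : Fin n → ℕ → Ω → ℝ)
    (m k : ℕ) (ω : Ω) : ℝ :=
  sharedTotal w N Y (dyadicTime m (k + 1)) ω - sharedTotal w N Y (dyadicTime m k) ω

section Model

variable {P : Measure Ω} [IsProbabilityMeasure P] {n : ℕ} {lam : Fin n → ℝ≥0}
  {N : Fin n → ℝ≥0 → Ω → ℕ} {Y : Fin n → ℕ → Ω → ℝ}

lemma IsLossModel.measurable_sharedTotal (h : IsLossModel lam N Y P) (w : Fin n → ℝ) (t : ℝ≥0) :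
    Measurable (sharedTotal w N Y t) :=
  Finset.measurable_sum _ fun j _ =>
    (measurable_claimTotal (h.poisson j).measurable (h.measurable_claim j) t).const_mul _

lemma IsLossModel.measurable_sharedIncrement (h : IsLossModel lam N Y P) (w : Fin n → ℝ)
    (m k : ℕ) : Measurable (sharedIncrement w N Y m k) :=
  (h.measurable_sharedTotal w _).sub (h.measurable_sharedTotal w _)

lemma sharedIncrement_eq (w : Fin n → ℝ) (m k : ℕ) (ω : Ω) :
    sharedIncrement w N Y m k ω = ∑ j, w j * (claimTotal (N j) (Y j) (dyadicTime m (k + 1)) ω -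
      claimTotal (N j) (Y j) (dyadicTime m k) ω) := by
  unfold sharedIncrement sharedTotal
  rw [← Finset.sum_sub_distrib]
  exact Finset.sum_congr rfl fun j _ => by ring

lemma IsLossModel.measurable_claimIncrement (h : IsLossModel lam N Y P) (j : Fin n) (s t : ℝ≥0) :
    Measurable fun ω => claimTotal (N j) (Y j) t ω - claimTotal (N j) (Y j) s ω :=
  (measurable_claimTotal (h.poisson j).measurable (h.measurable_claim j) _).sub
    (measurable_claimTotal (h.poisson j).measurable (h.measurable_claim j) _)

/-- Independence across participants and across periods makes the whole array of increments
independent; regrouping it by period instead of by participant gives the claim. -/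
lemma IsLossModel.iIndepFun_sharedIncrement (h : IsLossModel lam N Y P) (w : Fin n → ℝ) (m : ℕ) :
    iIndepFun (sharedIncrement w N Y m) P := by
  let ξ : Fin n → ℕ → Ω → ℝ := fun j k ω =>
    claimTotal (N j) (Y j) (dyadicTime m (k + 1)) ω - claimTotal (N j) (Y j) (dyadicTime m k) ω
  have hm : ∀ j k, Measurable (ξ j k) := fun j k => h.measurable_claimIncrement j _ _
  have h1 : iIndepFun (fun j ω k => ξ j k ω) P :=
    h.totals_indep.comp (fun j (s : ℝ≥0 → ℝ) k => s (dyadicTime m (k + 1)) - s (dyadicTime m k))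
      fun j => by fun_prop
  have h2 : ∀ j, iIndepFun (ξ j) P := fun j =>
    iIndepFun_claimIncrements (h.poisson j) (h.measurable_claim j) (h.claims_indep j)
      (h.claims_identDistrib j) (h.claims_indep_arrivals j) (monotone_dyadicTime m)
  have h3 := iIndepFun_uncurry' hm h1 h2
  have hinj : Function.Injective fun p : (_ : ℕ) × Fin n => (p.2, p.1) := by
    rintro ⟨a, b⟩ ⟨c, d⟩ h
    simp only [Prod.mk.injEq] at h
    rw [h.1, h.2]
  have h4 := iIndepFun_curry (X := fun (k : ℕ) (j : Fin n) => ξ j k) (fun k j => hm j k)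
    (h3.precomp hinj)
  have h5 := h4.comp (fun k (x : Fin n → ℝ) => ∑ j, w j * x j) fun k => by fun_prop
  convert! h5 using 2 with k
  funext ω
  exact sharedIncrement_eq w m k ω

lemma IsLossModel.identDistrib_sharedIncrement (h : IsLossModel lam N Y P) (w : Fin n → ℝ)
    (m k : ℕ) : IdentDistrib (sharedIncrement w N Y m k) (sharedIncrement w N Y m 0) P P := by
  have hcol : ∀ k, iIndepFun (fun j ω => claimTotal (N j) (Y j) (dyadicTime m (k + 1)) ω -
      claimTotal (N j) (Y j) (dyadicTime m k) ω) P := fun k =>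
    h.totals_indep.comp (fun j (s : ℝ≥0 → ℝ) => s (dyadicTime m (k + 1)) - s (dyadicTime m k))
      fun j => by fun_prop
  have := (IdentDistrib.pi (fun j => identDistrib_claimIncrements (h.poisson j)
    (h.measurable_claim j) (h.claims_indep j) (h.claims_identDistrib j)
    (h.claims_indep_arrivals j) (monotone_dyadicTime m) k
    (by rw [dyadicTime_succ_sub, dyadicTime_succ_sub])) (hcol k) (hcol 0)).comp
    (u := fun x : Fin n → ℝ => ∑ j, w j * x j) (by fun_prop)
  convert! this using 1
  · funext ω
    exact sharedIncrement_eq w m k ω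
  · funext ω
    exact sharedIncrement_eq w m 0 ω

lemma IsLossModel.ae_zero (h : IsLossModel lam N Y P) : ∀ᵐ ω ∂P, ∀ j, N j 0 ω = 0 :=
  ae_all_iff.2 fun j => (h.poisson j).zero

lemma IsLossModel.ae_monotone (h : IsLossModel lam N Y P) :
    ∀ᵐ ω ∂P, ∀ j, Monotone fun t => N j t ω :=
  ae_all_iff.2 fun j => (h.poisson j).monotone_paths

lemma IsLossModel.ae_rightContinuous (h : IsLossModel lam N Y P) :
    ∀ᵐ ω ∂P, ∀ j t, ContinuousWithinAt (fun s => N j s ω) (Set.Ici t) t :=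
  ae_all_iff.2 fun j => (h.poisson j).right_continuous_paths

lemma IsLossModel.ae_claimWalk_eq (h : IsLossModel lam N Y P) (w : Fin n → ℝ) (c : ℝ) :
    ∀ᵐ ω ∂P, ∀ m k, claimWalk (sharedIncrement w N Y m) (c * dyadicTime m 1) k ω =
      sharedTotal w N Y (dyadicTime m k) ω - c * dyadicTime m k := by
  filter_upwards [h.ae_zero] with ω hω m k
  have h0 : sharedTotal w N Y (dyadicTime m 0) ω = 0 := by
    simp [sharedTotal, claimTotal, dyadicTime_zero, hω]
  unfold claimWalk sharedIncrement
  rw [Finset.sum_range_sub (fun k => sharedTotal w N Y (dyadicTime m k) ω), h0,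
    coe_dyadicTime m k]
  ring

lemma IsLossModel.sharedIncrement_zero_ae_eq (h : IsLossModel lam N Y P) (w : Fin n → ℝ) (m : ℕ) :
    sharedIncrement w N Y m 0 =ᵐ[P] sharedTotal w N Y (dyadicTime m 1) := by
  filter_upwards [h.ae_zero] with ω hω
  simp [sharedIncrement, sharedTotal, claimTotal, dyadicTime_zero, hω]

lemma IsLossModel.integrable_claimTotal (h : IsLossModel lam N Y P) (j : Fin n) (t : ℝ≥0) :
    Integrable (claimTotal (N j) (Y j) t) P :=
  LinearRiskSharing.integrable_claimTotal (h.poisson j) (h.measurable_claim j) (h.claim_nonneg j)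
    (h.integrable_claim j 0) (h.claims_identDistrib j) (h.claims_indep_arrivals j) t

lemma IsLossModel.integral_claimTotal (h : IsLossModel lam N Y P) (j : Fin n) (t : ℝ≥0) :
    ∫ ω, claimTotal (N j) (Y j) t ω ∂P = lam j * t * meanClaim Y P j :=
  LinearRiskSharing.integral_claimTotal (h.poisson j) (h.measurable_claim j) (h.claim_nonneg j)
    (h.integrable_claim j 0) (h.claims_identDistrib j) (h.claims_indep_arrivals j) t

lemma IsLossModel.integrable_sharedTotal (h : IsLossModel lam N Y P) (w : Fin n → ℝ) (t : ℝ≥0) :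
    Integrable (sharedTotal w N Y t) P :=
  integrable_finsetSum _ fun j _ => (h.integrable_claimTotal j t).const_mul _

lemma IsLossModel.integral_sharedTotal (h : IsLossModel lam N Y P) (w : Fin n → ℝ) (t : ℝ≥0) :
    ∫ ω, sharedTotal w N Y t ω ∂P = (∑ j, lam j * w j * meanClaim Y P j) * t := by
  unfold sharedTotal
  rw [integral_finsetSum _ fun j _ => (h.integrable_claimTotal j t).const_mul _, Finset.sum_mul]
  refine Finset.sum_congr rfl fun j _ => ?_
  rw [integral_const_mul, h.integral_claimTotal]
  ring

lemma IsLossModel.ae_claimTotal_nonneg (h : IsLossModel lam N Y P) :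
    ∀ᵐ ω ∂P, ∀ j t, 0 ≤ claimTotal (N j) (Y j) t ω :=
  ae_all_iff.2 fun j => claimTotal_nonneg (h.claim_nonneg j)

lemma IsLossModel.meanClaim_nonneg (h : IsLossModel lam N Y P) (j : Fin n) :
    0 ≤ meanClaim Y P j :=
  integral_nonneg_of_ae (h.claim_nonneg j 0)

/-- A sublinear function of a sum is the sum of its values, up to terms in which two summands are
non-zero. -/
lemma IsSublinear.sum_le {g : ℝ → ℝ} (hg : IsSublinear g) {ι : Type*} [Fintype ι] [DecidableEq ι]
    {x : ι → ℝ} (hx : ∀ j, 0 ≤ x j) :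
    g (∑ j, x j) ≤ ∑ j, g (x j) + ∑ j, ∑ k ∈ Finset.univ.erase j, if x k ≠ 0 then x j else 0 := by
  have hterm : ∀ j k, 0 ≤ if x k ≠ 0 then x j else 0 := fun j k => by
    split_ifs
    exacts [hx j, le_rfl]
  have hcross : 0 ≤ ∑ j, ∑ k ∈ Finset.univ.erase j, if x k ≠ 0 then x j else 0 :=
    Finset.sum_nonneg fun j _ => Finset.sum_nonneg fun k _ => hterm j k
  -- Either at most one summand is non-zero and no cross term is needed, or every `x j` has a
  -- non-zero partner and the cross terms alone dominate the sum.
  by_cases h : ∃ j, ∀ k, k ≠ j → x k = 0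
  · obtain ⟨j, hj⟩ := h
    have h1 : ∑ k, x k = x j := Finset.sum_eq_single j (fun k _ hk => hj k hk) (by simp)
    have h2 : g (x j) ≤ ∑ k, g (x k) :=
      Finset.single_le_sum (f := fun k => g (x k)) (fun k _ => hg.nonneg _ (hx k))
        (Finset.mem_univ j)
    rw [h1]
    linarith
  · push Not at h
    have h1 : ∑ j, x j ≤ ∑ j, ∑ k ∈ Finset.univ.erase j, if x k ≠ 0 then x j else 0 := by
      refine Finset.sum_le_sum fun j _ => ?_
      obtain ⟨k, hkj, hk⟩ := h j
      have := Finset.single_le_sum (f := fun k => if x k ≠ 0 then x j else 0)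
        (fun k _ => hterm j k) (Finset.mem_erase.2 ⟨hkj, Finset.mem_univ k⟩)
      simpa [hk] using this
    have h2 := hg.le_self _ (Finset.sum_nonneg (s := Finset.univ) fun j _ => hx j)
    have h3 : 0 ≤ ∑ j, g (x j) := Finset.sum_nonneg fun j _ => hg.nonneg _ (hx j)
    linarith

/-- The two factors are independent, and participant `k` has a non-zero total with probability at
most `lam k * t`; cross terms are thus of second order. -/
lemma IsLossModel.integral_cross_le (h : IsLossModel lam N Y P) {w : Fin n → ℝ}
    (hw : ∀ j, 0 ≤ w j) (t : ℝ≥0) {j k : Fin n} (hjk : j ≠ k) :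
    Integrable (fun ω => if w k * claimTotal (N k) (Y k) t ω ≠ 0
      then w j * claimTotal (N j) (Y j) t ω else 0) P ∧
    ∫ ω, (if w k * claimTotal (N k) (Y k) t ω ≠ 0 then w j * claimTotal (N j) (Y j) t ω else 0) ∂P
      ≤ w j * (lam j * t * meanClaim Y P j) * (lam k * t) := by
  have hmS : ∀ j, Measurable (claimTotal (N j) (Y j) t) := fun j =>
    measurable_claimTotal (h.poisson j).measurable (h.measurable_claim j) t
  have hset : MeasurableSet {ω | w k * claimTotal (N k) (Y k) t ω ≠ 0} :=
    (((hmS k).const_mul (w k)) (measurableSet_singleton 0)).compl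
  have hint : Integrable (fun ω => w j * claimTotal (N j) (Y j) t ω) P :=
    (h.integrable_claimTotal j t).const_mul _
  let v : ℝ → ℝ := fun x => if w k * x ≠ 0 then 1 else 0
  have hv : Measurable v := by
    refine Measurable.ite ?_ measurable_const measurable_const
    exact ((measurable_const_mul (w k)) (measurableSet_singleton 0)).compl
  have heq : ∀ ω, (if w k * claimTotal (N k) (Y k) t ω ≠ 0
      then w j * claimTotal (N j) (Y j) t ω else 0) =
      (w j * claimTotal (N j) (Y j) t ω) * v (claimTotal (N k) (Y k) t ω) := by
    intro ω
    simp only [v]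
    split_ifs <;> simp
  have heq2 : ∀ ω, v (claimTotal (N k) (Y k) t ω) =
      {ω | w k * claimTotal (N k) (Y k) t ω ≠ 0}.indicator 1 ω := by
    intro ω
    simp [v, Set.indicator_apply]
  have hind : IndepFun (fun ω => w j * claimTotal (N j) (Y j) t ω)
      (fun ω => v (claimTotal (N k) (Y k) t ω)) P :=
    (h.totals_indep.indepFun hjk).comp (φ := fun s : ℝ≥0 → ℝ => w j * s t)
      (ψ := fun s : ℝ≥0 → ℝ => v (s t)) (by fun_prop) (hv.comp (measurable_pi_apply t))
  constructor
  · refine (hint.indicator hset).congr (ae_of_all _ fun ω => ?_)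
    simp [Set.indicator_apply]
  · simp_rw [heq]
    rw [hind.integral_fun_mul_eq_mul_integral hint.aestronglyMeasurable
      (hv.comp (hmS k)).aestronglyMeasurable, integral_const_mul, h.integral_claimTotal]
    simp_rw [heq2]
    rw [integral_indicator_one hset]
    have hb := h.meanClaim_nonneg j
    have hwj := hw j
    gcongr
    refine (measureReal_mono fun ω hω => ?_).trans
      (probReal_claimTotal_ne_zero_le (Y := Y k) (h.poisson k) t)
    exact right_ne_zero_of_mul hω

/-- First-order upper bound for the mean of a sublinear function of the shared claims over a short
period. -/
lemma IsLossModel.integral_sublinear_sharedTotal_le (h : IsLossModel lam N Y P) {w : Fin n → ℝ}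
    (hw : ∀ j, 0 ≤ w j) (t : ℝ≥0) {g : ℝ → ℝ} (hg : IsSublinear g) :
    ∫ ω, g (sharedTotal w N Y t ω) ∂P ≤ t * (∑ j, lam j * ∫ ω, g (w j * Y j 0 ω) ∂P +
      t * ((∑ j, lam j * w j * meanClaim Y P j) * ∑ k, (lam k : ℝ))) := by
  have hmS : ∀ j, Measurable (claimTotal (N j) (Y j) t) := fun j =>
    measurable_claimTotal (h.poisson j).measurable (h.measurable_claim j) t
  have h0 := h.ae_claimTotal_nonneg
  have hi1 : ∀ j, Integrable (fun ω => g (w j * claimTotal (N j) (Y j) t ω)) P := fun j =>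
    hg.integrable ((h.integrable_claimTotal j t).const_mul _) ((hmS j).const_mul _)
      (h0.mono fun ω hω => mul_nonneg (hw j) (hω j t))
  have hi2 : ∀ j, Integrable (fun ω => ∑ k ∈ Finset.univ.erase j,
      if w k * claimTotal (N k) (Y k) t ω ≠ 0 then w j * claimTotal (N j) (Y j) t ω else 0) P :=
    fun j => integrable_finsetSum _ fun k hk =>
      (h.integral_cross_le hw t (Finset.ne_of_mem_erase hk).symm).1
  have hle : ∫ ω, g (sharedTotal w N Y t ω) ∂P ≤
      ∫ ω, ((∑ j, g (w j * claimTotal (N j) (Y j) t ω)) +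
        ∑ j, ∑ k ∈ Finset.univ.erase j,
          if w k * claimTotal (N k) (Y k) t ω ≠ 0 then w j * claimTotal (N j) (Y j) t ω else 0)
        ∂P := by
    refine integral_mono_ae ?_ ?_ ?_
    · refine hg.integrable (h.integrable_sharedTotal w t) (h.measurable_sharedTotal w t) ?_
      filter_upwards [h0] with ω hω
      exact Finset.sum_nonneg fun j _ => mul_nonneg (hw j) (hω j t)
    · exact (integrable_finsetSum _ fun j _ => hi1 j).add (integrable_finsetSum _ fun j _ => hi2 j)
    · filter_upwards [h0] with ω hω
      exact hg.sum_le (x := fun j => w j * claimTotal (N j) (Y j) t ω)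
        fun j => mul_nonneg (hw j) (hω j t)
  refine hle.trans ?_
  rw [integral_add (integrable_finsetSum _ fun j _ => hi1 j)
    (integrable_finsetSum _ fun j _ => hi2 j), integral_finsetSum _ fun j _ => hi1 j,
    integral_finsetSum _ fun j _ => hi2 j]
  have hsingle : ∀ j, ∫ ω, g (w j * claimTotal (N j) (Y j) t ω) ∂P ≤
      lam j * t * ∫ ω, g (w j * Y j 0 ω) ∂P + w j * (lam j * t * meanClaim Y P j) * (lam j * t) :=
    fun j => integral_sublinear_le (h.poisson j) (h.measurable_claim j) (h.claim_nonneg j)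
      (h.integrable_claim j 0) (h.claims_identDistrib j) (h.claims_indep_arrivals j) t hg (hw j)
  have hcross : ∀ j, ∫ ω, (∑ k ∈ Finset.univ.erase j,
      if w k * claimTotal (N k) (Y k) t ω ≠ 0 then w j * claimTotal (N j) (Y j) t ω else 0) ∂P ≤
      ∑ k ∈ Finset.univ.erase j, w j * (lam j * t * meanClaim Y P j) * (lam k * t) := by
    intro j
    rw [integral_finsetSum _ fun k hk =>
      (h.integral_cross_le hw t (Finset.ne_of_mem_erase hk).symm).1]
    exact Finset.sum_le_sum fun k hk =>
      (h.integral_cross_le hw t (Finset.ne_of_mem_erase hk).symm).2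
  refine (add_le_add (Finset.sum_le_sum fun j _ => hsingle j)
    (Finset.sum_le_sum fun j _ => hcross j)).trans_eq ?_
  rw [Finset.sum_mul_sum, mul_add, Finset.mul_sum, Finset.mul_sum, Finset.mul_sum,
    Finset.sum_add_distrib, add_assoc, ← Finset.sum_add_distrib]
  congr 1
  · exact Finset.sum_congr rfl fun j _ => by ring
  · refine Finset.sum_congr rfl fun j _ => ?_
    -- The second-order error of each single participant is exactly the diagonal term missing from
    -- the cross terms, so together they form the full product of sums.
    rw [Finset.add_sum_erase _ (fun k => w j * (lam j * t * meanClaim Y P j) * (lam k * t))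
      (Finset.mem_univ j), Finset.mul_sum, Finset.mul_sum]
    exact Finset.sum_congr rfl fun k _ => by ring

end Model

/-! ### Absence of simultaneous claims, and ruin on dyadic times. -/

section Model

variable {P : Measure Ω} [IsProbabilityMeasure P] {n : ℕ} {lam : Fin n → ℝ≥0}
  {N : Fin n → ℝ≥0 → Ω → ℕ} {Y : Fin n → ℕ → Ω → ℝ}

/-- The probability that two or more claims are reported to the pool over a short period is of
second order. -/
lemma IsLossModel.probReal_poolCount_le (h : IsLossModel lam N Y P) {s t : ℝ≥0} (hst : s ≤ t) :
    P.real {ω | poolCount N s ω + 1 < poolCount N t ω} ≤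
      (∑ j, (lam j : ℝ)) ^ 2 * ((t - s : ℝ≥0) : ℝ) ^ 2 := by
  let M : Fin n → Ω → ℕ := fun j ω => N j t ω - N j s ω
  have hm : ∀ j, Measurable (M j) := fun j =>
    ((h.poisson j).measurable t).sub ((h.poisson j).measurable s)
  have hlaw : ∀ j, HasLaw (M j) (poissonMeasure (lam j * (t - s))) P := fun j =>
    (h.poisson j).law_increments s t hst
  have hind : iIndepFun M P :=
    h.arrivals_indep.comp (fun j (x : ℝ≥0 → ℕ) => x t - x s) fun j => by fun_prop
  -- Two claims in the pool come from one participant (diagonal) or from two distinct ones; either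
  -- way the probability is at most a product of two first-order terms.
  let B : Fin n → Fin n → Set Ω := fun j k =>
    if j = k then {ω | 2 ≤ M j ω} else {ω | M j ω ≠ 0} ∩ {ω | M k ω ≠ 0}
  have hB : ∀ j k, P.real (B j k) ≤ (lam j * (t - s : ℝ≥0)) * (lam k * (t - s : ℝ≥0)) := by
    intro j k
    by_cases hjk : j = k
    · subst hjk
      simp only [B, if_true]
      refine (hasLaw_poisson_two_le (hm j) (hlaw j)).trans_eq ?_
      push_cast
      ring
    · simp only [B, if_neg hjk]
      have := (hind.indepFun hjk).measure_inter_preimage_eq_mul {x | x ≠ 0} {x | x ≠ 0}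
        (.of_discrete) (.of_discrete)
      have h2 : P.real ({ω | M j ω ≠ 0} ∩ {ω | M k ω ≠ 0}) =
          P.real {ω | M j ω ≠ 0} * P.real {ω | M k ω ≠ 0} := by
        rw [measureReal_def, measureReal_def, measureReal_def, ← ENNReal.toReal_mul]
        exact congrArg _ this
      rw [h2]
      have h3 := hasLaw_poisson_ne_zero_le (hm j) (hlaw j)
      have h4 := hasLaw_poisson_ne_zero_le (hm k) (hlaw k)
      rw [NNReal.coe_mul] at h3 h4
      gcongr
  have hsub : {ω | poolCount N s ω + 1 < poolCount N t ω} ≤ᵐ[P] ⋃ j, ⋃ k, B j k := by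
    filter_upwards [h.ae_monotone] with ω hω
    intro (hlt : poolCount N s ω + 1 < poolCount N t ω)
    have hsum : ∑ j, M j ω = poolCount N t ω - poolCount N s ω :=
      Finset.sum_tsub_distrib _ fun j _ => hω j hst
    change ω ∈ ⋃ j, ⋃ k, B j k
    simp only [Set.mem_iUnion]
    by_contra! hcon
    have h1 : ∀ j, M j ω ≤ 1 := fun j => by
      have := hcon j j
      simp only [B, if_true, Set.mem_ofPred_eq] at this
      omega
    obtain ⟨j, hj⟩ : ∃ j, M j ω ≠ 0 := by
      by_contra! h0
      rw [Finset.sum_eq_zero fun j _ => h0 j] at hsum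
      omega
    have h2 : ∀ k, k ≠ j → M k ω = 0 := by
      intro k hkj
      have := hcon j k
      simp only [B, if_neg (Ne.symm hkj), Set.mem_inter_iff, Set.mem_ofPred_eq, not_and,
        not_not] at this
      exact this hj
    rw [Finset.sum_eq_single j (fun k _ hk => h2 k hk) (by simp)] at hsum
    have := h1 j
    omega
  calc P.real {ω | poolCount N s ω + 1 < poolCount N t ω}
      ≤ P.real (⋃ j, ⋃ k, B j k) :=
        ENNReal.toReal_mono (measure_ne_top _ _) (measure_mono_ae hsub)
    _ ≤ ∑ j, ∑ k, P.real (B j k) :=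
        (measureReal_iUnion_fintype_le _).trans
          (Finset.sum_le_sum fun j _ => measureReal_iUnion_fintype_le _)
    _ ≤ ∑ j, ∑ k, (lam j * ((t - s : ℝ≥0) : ℝ)) * (lam k * ((t - s : ℝ≥0) : ℝ)) :=
        Finset.sum_le_sum fun j _ => Finset.sum_le_sum fun k _ => hB j k
    _ = _ := by rw [← Finset.sum_mul_sum, ← Finset.sum_mul]; ring

/-- Almost surely, no two claims are reported to the pool at the same time. -/
lemma IsLossModel.ae_simple (h : IsLossModel lam N Y P) :
    ∀ᵐ ω ∂P, ∀ K : ℕ, ∃ m : ℕ, ∀ k < K * 2 ^ m,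
      poolCount N (dyadicTime m (k + 1)) ω ≤ poolCount N (dyadicTime m k) ω + 1 := by
  rw [ae_all_iff]
  intro K
  let F : ℕ → Set Ω := fun m => ⋃ k ∈ Finset.range (K * 2 ^ m),
    {ω | poolCount N (dyadicTime m k) ω + 1 < poolCount N (dyadicTime m (k + 1)) ω}
  -- Union bound: `K * 2 ^ m` cells, each contributing a multiple of the squared mesh.
  have hF : ∀ m, P.real (F m) ≤ K * (∑ j, (lam j : ℝ)) ^ 2 * dyadicTime m 1 := by
    intro m
    calc P.real (F m) ≤ ∑ k ∈ Finset.range (K * 2 ^ m), P.real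
          {ω | poolCount N (dyadicTime m k) ω + 1 < poolCount N (dyadicTime m (k + 1)) ω} :=
          measureReal_biUnion_finset_le _ _
      _ ≤ ∑ k ∈ Finset.range (K * 2 ^ m),
          (∑ j, (lam j : ℝ)) ^ 2 * (dyadicTime m 1 : ℝ) ^ 2 := by
          refine Finset.sum_le_sum fun k _ => ?_
          have := h.probReal_poolCount_le (monotone_dyadicTime m k.le_succ)
          rwa [dyadicTime_succ_sub] at this
      _ = K * (∑ j, (lam j : ℝ)) ^ 2 * dyadicTime m 1 := by
          rw [Finset.sum_const, Finset.card_range, nsmul_eq_mul]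
          simp [dyadicTime]
          field_simp
  have h0 : P.real (⋂ m, F m) = 0 := by
    refine le_antisymm ?_ measureReal_nonneg
    have hlim := (tendsto_dyadicTime_one).const_mul (K * (∑ j, (lam j : ℝ)) ^ 2)
    rw [mul_zero] at hlim
    exact ge_of_tendsto' hlim fun m =>
      (measureReal_mono (Set.iInter_subset _ m) (measure_ne_top _ _)).trans (hF m)
  rw [measureReal_eq_zero_iff] at h0
  refine measure_mono_null (fun ω hω => ?_) h0
  simp only [Set.mem_compl_iff, Set.mem_ofPred_eq, not_exists, not_forall, not_le] at hω
  simp only [F, Set.mem_iInter, Set.mem_iUnion, Finset.mem_range, Set.mem_ofPred_eq]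
  intro m
  obtain ⟨k, hk, hlt⟩ := hω m
  exact ⟨k, hk, hlt⟩

/-- Almost surely, the cumulative amount borne by a participant of the pool is the linear
combination of the cumulative claims of all participants. -/
lemma IsLossModel.ae_claimTotal_poolCount_eq (h : IsLossModel lam N Y P)
    (A : Matrix (Fin n) (Fin n) ℝ) (i : Fin n) :
    ∀ᵐ ω ∂P, ∀ t, claimTotal (poolCount N) (pooledPayment A N Y i) t ω =
      sharedTotal (A i) N Y t ω := by
  filter_upwards [h.ae_zero, h.ae_monotone, h.ae_rightContinuous, h.ae_simple] with ω h0 h1 h2 h3 t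
  exact claimTotal_poolCount_eq h0 h1 h2 h3 t

/-- The tail function of the supremum of the aggregate loss over all dyadic times. -/
def dyadicRuin (P : Measure Ω) (w : Fin n → ℝ) (N : Fin n → ℝ≥0 → Ω → ℕ)
    (Y : Fin n → ℕ → Ω → ℝ) (c : ℝ) : ℝ → ℝ :=
  supTail P fun p : ℕ × ℕ => claimWalk (sharedIncrement w N Y p.1) (c * dyadicTime p.1 1) p.2

/-- The tail function of the supremum of the aggregate loss over a dyadic grid. -/
def gridRuin (P : Measure Ω) (w : Fin n → ℝ) (N : Fin n → ℝ≥0 → Ω → ℕ)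
    (Y : Fin n → ℕ → Ω → ℝ) (c : ℝ) (m : ℕ) : ℝ → ℝ :=
  supTail P (claimWalk (sharedIncrement w N Y m) (c * dyadicTime m 1))

lemma dyadicRuin_of_neg {w : Fin n → ℝ} {c : ℝ} {u : ℝ} (hu : u < 0) :
    dyadicRuin P w N Y c u = 1 :=
  supTail_eq_one (ae_of_all _ fun ω => ⟨(0, 0), by simpa [claimWalk] using hu⟩)

lemma gridRuin_le_dyadicRuin {w : Fin n → ℝ} {c : ℝ} (m : ℕ) (u : ℝ) :
    gridRuin P w N Y c m u ≤ dyadicRuin P w N Y c u :=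
  measureReal_mono fun _ ⟨k, hk⟩ => ⟨(m, k), hk⟩

/-- The dyadic grids are nested, so the exceedance events increase up to null sets and continuity
from below applies. -/
lemma IsLossModel.tendsto_gridRuin (h : IsLossModel lam N Y P) (w : Fin n → ℝ) (c u : ℝ) :
    Tendsto (fun m => gridRuin P w N Y c m u) atTop (nhds (dyadicRuin P w N Y c u)) := by
  let D : ℕ → Set Ω := fun m =>
    {ω | ∃ k, u < sharedTotal w N Y (dyadicTime m k) ω - c * dyadicTime m k}
  have hD : Monotone D := by
    refine monotone_nat_of_le_succ fun m ω ⟨k, hk⟩ => ⟨2 * k, ?_⟩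
    have : dyadicTime (m + 1) (2 * k) = dyadicTime m k := by
      unfold dyadicTime
      rw [pow_succ', Nat.cast_mul]
      exact mul_div_mul_left _ _ two_ne_zero
    rwa [this]
  have hae := h.ae_claimWalk_eq w c
  have h1 : ∀ m, gridRuin P w N Y c m u = P.real (D m) := by
    intro m
    refine measureReal_congr ?_
    filter_upwards [hae] with ω hω
    apply propext
    change (∃ k, u < _) ↔ ∃ k, u < _
    simp_rw [hω]
  have h2 : dyadicRuin P w N Y c u = P.real (⋃ m, D m) := by
    refine measureReal_congr ?_
    filter_upwards [hae] with ω hω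
    apply propext
    change (∃ p : ℕ × ℕ, u < _) ↔ ω ∈ ⋃ m, D m
    simp only [Set.mem_iUnion, D, Set.mem_ofPred_eq, Prod.exists, hω]
  simp_rw [h1]
  rw [h2]
  exact (ENNReal.tendsto_toReal (measure_ne_top _ _)).comp (tendsto_measure_iUnion_atTop hD)

lemma exists_dyadicTime_mem {s t : ℝ≥0} (hst : s < t) :
    ∃ m k, s ≤ dyadicTime m k ∧ dyadicTime m k < t := by
  have hst' : (0 : ℝ) < t - s := sub_pos.2 (by exact_mod_cast hst)
  obtain ⟨m, hm⟩ := (tendsto_dyadicTime_one.eventually_lt_const hst').exists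
  have hpos := dyadicTime_one_pos m
  -- The first grid point not before `s` overshoots it by less than the mesh, which is below `t -
  -- s`.
  refine ⟨m, ⌈(s : ℝ) / dyadicTime m 1⌉₊, ?_, ?_⟩
  · rw [← NNReal.coe_le_coe, coe_dyadicTime, ← div_le_iff₀ hpos]
    exact Nat.le_ceil _
  · rw [← NNReal.coe_lt_coe, coe_dyadicTime]
    have := Nat.ceil_lt_add_one (a := (s : ℝ) / dyadicTime m 1) (by positivity)
    have h2 := mul_lt_mul_of_pos_right this hpos
    rw [add_mul, div_mul_cancel₀ _ hpos.ne', one_mul] at h2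
    linarith

/-- For a surplus whose cumulative losses are almost surely the shared cumulative claims, ruin is
already detected on the dyadic times. -/
lemma IsLossModel.ruinProb_eq (h : IsLossModel lam N Y P) (w : Fin n → ℝ) (c κ : ℝ)
    {S : ℝ≥0 → Ω → ℝ} (hS : ∀ᵐ ω ∂P, ∀ t, S t ω = sharedTotal w N Y t ω) :
    ruinProb P (surplus c κ S) = ENNReal.ofReal (dyadicRuin P w N Y c κ) := by
  unfold ruinProb dyadicRuin supTail
  rw [ofReal_measureReal]
  refine measure_congr ?_
  filter_upwards [hS, h.ae_claimWalk_eq w c, h.ae_rightContinuous] with ω h1 h2 h3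
  apply propext
  change (⨅ t : ℝ≥0, ((surplus c κ S t ω : ℝ) : EReal)) < 0 ↔ ∃ p : ℕ × ℕ, κ < _
  simp_rw [iInf_lt_iff, h2]
  unfold surplus
  constructor
  · rintro ⟨t, ht⟩
    have ht' : c * t - sharedTotal w N Y t ω + κ < 0 := by
      rw [h1] at ht
      exact_mod_cast ht
    -- Losses are constant just after `t` and the premium is continuous, so a strictly negative
    -- surplus persists to some later dyadic time.
    choose u hu hconst using fun j => exists_forall_eq_of_continuousWithinAt (h3 j t)
    have hshared : ∀ᶠ s in nhdsWithin t (Set.Ioi t),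
        sharedTotal w N Y s ω = sharedTotal w N Y t ω := by
      have : ∀ᶠ s in nhdsWithin t (Set.Ioi t), ∀ j, N j s ω = N j t ω := by
        rw [eventually_all]
        intro j
        filter_upwards [Ioo_mem_nhdsGT (hu j)] with s hs
        exact hconst j s hs.1.le hs.2
      filter_upwards [this] with s hs
      simp [sharedTotal, claimTotal, hs]
    have hlin : ∀ᶠ s : ℝ≥0 in nhdsWithin t (Set.Ioi t),
        c * s - sharedTotal w N Y t ω + κ < 0 := by
      have hc : Continuous fun s : ℝ≥0 => c * s - sharedTotal w N Y t ω + κ := by fun_prop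
      exact (hc.tendsto t).eventually_lt_const ht' |>.filter_mono nhdsWithin_le_nhds
    have hboth := hshared.and hlin
    rw [eventually_iff, mem_nhdsGT_iff_exists_Ioo_subset] at hboth
    obtain ⟨v, hv, hsub⟩ := hboth
    obtain ⟨t', ht1, ht2⟩ := exists_between (show t < v from hv)
    obtain ⟨m, k, hk1, hk2⟩ := exists_dyadicTime_mem ht2
    obtain ⟨e1, e2⟩ := hsub ⟨ht1.trans_le hk1, hk2⟩
    refine ⟨(m, k), ?_⟩
    simp only [e1]
    linarith
  · rintro ⟨p, hp⟩
    refine ⟨dyadicTime p.1 p.2, ?_⟩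
    rw [h1]
    have : c * (dyadicTime p.1 p.2 : ℝ) - sharedTotal w N Y (dyadicTime p.1 p.2) ω + κ < 0 := by
      linarith
    exact_mod_cast this

end Model

/-! ### Primitives of antitone functions. -/

section Primitive

variable {φ : ℝ → ℝ}

lemma intervalIntegrable_comp_sub (hφ : Antitone φ) (v x y : ℝ) :
    IntervalIntegrable (fun x => φ (v - x)) volume x y :=
  Monotone.intervalIntegrable fun _ _ h => hφ (by linarith)

lemma isSublinear_primitive (hφ : Antitone φ) (h0 : ∀ u, 0 ≤ φ u) (h1 : ∀ u, φ u ≤ 1) (v : ℝ) :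
    IsSublinear fun y => ∫ x in (0 : ℝ)..y, φ (v - x) where
  measurable := (intervalIntegral.continuous_primitive
    (fun _ _ => intervalIntegrable_comp_sub hφ v _ _) 0).measurable
  zero := intervalIntegral.integral_same
  nonneg y hy := intervalIntegral.integral_nonneg hy fun _ _ => h0 _
  le_self y hy := by
    have := abs_intervalIntegral_le (φ := fun x => φ (v - x)) (fun u => h0 _) (fun u => h1 _) 0 y
    rw [sub_zero, abs_of_nonneg hy] at this
    exact (le_abs_self _).trans this

/-- The primitive of a monotone function is star-shaped. -/
lemma primitive_mul_le (hφ : Antitone φ) (v : ℝ) {r y : ℝ} (hr0 : 0 ≤ r) (hr1 : r ≤ 1)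
    (hy : 0 ≤ y) :
    ∫ x in (0 : ℝ)..r * y, φ (v - x) ≤ r * ∫ x in (0 : ℝ)..y, φ (v - x) := by
  have h := intervalIntegral.mul_integral_comp_mul_left (a := 0) (b := y)
    (f := fun x => φ (v - x)) r
  rw [mul_zero] at h
  rw [← h]
  refine mul_le_mul_of_nonneg_left (intervalIntegral.integral_mono_on hy ?_
    (intervalIntegrable_comp_sub hφ v _ _) fun x hx => hφ ?_) hr0
  · exact Monotone.intervalIntegrable fun x y hxy =>
      hφ (by have := mul_le_mul_of_nonneg_left hxy hr0; linarith)
  · have := mul_le_mul_of_nonneg_right hr1 hx.1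
    linarith

end Primitive

/-! ### Renewal inequalities and comparison of ruin probabilities. -/

section Model

variable {P : Measure Ω} [IsProbabilityMeasure P] {n : ℕ} {lam : Fin n → ℝ≥0}
  {N : Fin n → ℝ≥0 → Ω → ℕ} {Y : Fin n → ℕ → Ω → ℝ}

/-- The integrated renewal equation for ruin on a dyadic grid. -/
lemma IsLossModel.intervalIntegral_gridRuin_eq (h : IsLossModel lam N Y P) {w : Fin n → ℝ} {c : ℝ}
    (hc : ∑ j, lam j * w j * meanClaim Y P j < c) (m : ℕ) {v : ℝ} (hv : 0 ≤ v) :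
    ∫ u in v..v + c * dyadicTime m 1, gridRuin P w N Y c m u =
      ∫ ω, (∫ x in (0 : ℝ)..sharedTotal w N Y (dyadicTime m 1) ω,
        gridRuin P w N Y c m (v + c * dyadicTime m 1 - x)) ∂P := by
  have hae := h.sharedIncrement_zero_ae_eq w m
  have hint : Integrable (sharedIncrement w N Y m 0) P :=
    (h.integrable_sharedTotal w _).congr hae.symm
  have hmean : ∫ ω, sharedIncrement w N Y m 0 ω ∂P < c * dyadicTime m 1 := by
    rw [integral_congr_ae hae, h.integral_sharedTotal]
    exact mul_lt_mul_of_pos_right hc (dyadicTime_one_pos m)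
  refine (intervalIntegral_supTail_eq (h.measurable_sharedIncrement w m)
    (h.iIndepFun_sharedIncrement w m) (h.identDistrib_sharedIncrement w m) hint hmean hv).trans ?_
  refine integral_congr_ae ?_
  filter_upwards [hae] with ω hω
  rw [hω]
  rfl

lemma antitone_gridRuin (w : Fin n → ℝ) (c : ℝ) (m : ℕ) : Antitone (gridRuin P w N Y c m) :=
  antitone_supTail

lemma antitone_dyadicRuin (w : Fin n → ℝ) (c : ℝ) : Antitone (dyadicRuin P w N Y c) :=
  antitone_supTail

/-- The ruin probability is a subsolution of the renewal equation of the aggregate claims. -/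
lemma IsLossModel.mul_dyadicRuin_le (h : IsLossModel lam N Y P) {w : Fin n → ℝ}
    (hw : ∀ j, 0 ≤ w j) {c : ℝ} (hc0 : 0 ≤ c) (hc : ∑ j, lam j * w j * meanClaim Y P j < c)
    {v : ℝ} (hv : 0 < v) :
    c * dyadicRuin P w N Y c v ≤ ∑ j, lam j *
      ∫ ω, (∫ x in (0 : ℝ)..w j * Y j 0 ω, dyadicRuin P w N Y c (v - x)) ∂P := by
  set ψ := dyadicRuin P w N Y c
  have hψ : Antitone ψ := antitone_dyadicRuin w c
  have hsub : IsSublinear fun y => ∫ x in (0 : ℝ)..y, ψ (v - x) :=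
    isSublinear_primitive hψ supTail_nonneg supTail_le_one v
  set J : ℝ := ∑ j, lam j * ∫ ω, (∫ x in (0 : ℝ)..w j * Y j 0 ω, ψ (v - x)) ∂P
  set C : ℝ := (∑ j, lam j * w j * meanClaim Y P j) * ∑ k, (lam k : ℝ)
  have hlim1 : Tendsto (fun m => c * gridRuin P w N Y c m v) atTop (nhds (c * ψ v)) :=
    (h.tendsto_gridRuin w c v).const_mul c
  have hlim2 : Tendsto (fun m => J + dyadicTime m 1 * C) atTop (nhds (J + 0 * C)) :=
    (tendsto_dyadicTime_one.mul_const C).const_add J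
  rw [zero_mul, add_zero] at hlim2
  have hstep : Tendsto (fun m => c * (dyadicTime m 1 : ℝ)) atTop (nhds (c * 0)) :=
    tendsto_dyadicTime_one.const_mul c
  rw [mul_zero] at hstep
  refine le_of_tendsto_of_tendsto hlim1 hlim2 ?_
  -- The grid identity is used with base level `v - a`, which must be non-negative; this holds for
  -- fine grids because `v > 0`.
  filter_upwards [hstep.eventually_le_const hv] with m hm
  set a := c * (dyadicTime m 1 : ℝ)
  have hpos := dyadicTime_one_pos m
  have ha : 0 ≤ a := mul_nonneg hc0 hpos.le
  have heq := h.intervalIntegral_gridRuin_eq hc m (sub_nonneg.2 hm)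
  rw [sub_add_cancel] at heq
  have hle1 : a * gridRuin P w N Y c m v ≤ ∫ u in (v - a)..v, gridRuin P w N Y c m u := by
    have h1 : ∫ _ in (v - a)..v, gridRuin P w N Y c m v = a * gridRuin P w N Y c m v := by
      rw [intervalIntegral.integral_const, sub_sub_cancel, smul_eq_mul]
    rw [← h1]
    exact intervalIntegral.integral_mono_on (by linarith) intervalIntegrable_const
      (antitone_gridRuin w c m).intervalIntegrable fun u hu => antitone_gridRuin w c m hu.2
  have hm0 := h.measurable_sharedTotal w (dyadicTime m 1)
  have hi0 := h.integrable_sharedTotal w (dyadicTime m 1)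
  have hnn : ∀ᵐ ω ∂P, 0 ≤ sharedTotal w N Y (dyadicTime m 1) ω := by
    filter_upwards [h.ae_claimTotal_nonneg] with ω hω
    exact Finset.sum_nonneg fun j _ => mul_nonneg (hw j) (hω j _)
  have hle2 : ∫ ω, (∫ x in (0 : ℝ)..sharedTotal w N Y (dyadicTime m 1) ω,
      gridRuin P w N Y c m (v - x)) ∂P ≤
      ∫ ω, (∫ x in (0 : ℝ)..sharedTotal w N Y (dyadicTime m 1) ω, ψ (v - x)) ∂P := by
    refine integral_mono_ae ((isSublinear_primitive (antitone_gridRuin w c m) supTail_nonneg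
      supTail_le_one v).integrable hi0 hm0 hnn) (hsub.integrable hi0 hm0 hnn) ?_
    filter_upwards [hnn] with ω hω
    exact intervalIntegral.integral_mono_on hω
      (intervalIntegrable_comp_sub (antitone_gridRuin w c m) v _ _)
      (intervalIntegrable_comp_sub hψ v _ _) fun x _ => gridRuin_le_dyadicRuin m _
  have hle3 := h.integral_sublinear_sharedTotal_le hw (dyadicTime m 1) hsub
  have hfin : dyadicTime m 1 * (c * gridRuin P w N Y c m v) ≤
      dyadicTime m 1 * (J + dyadicTime m 1 * C) := by
    calc dyadicTime m 1 * (c * gridRuin P w N Y c m v) = a * gridRuin P w N Y c m v := by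
          simp only [a]; ring
      _ ≤ _ := hle1
      _ = _ := heq
      _ ≤ _ := hle2
      _ ≤ _ := hle3
  exact le_of_mul_le_mul_left hfin hpos

/-- The stand-alone surplus is the case of unit weight on participant `i`, so the results for shared
claims cover it. -/
lemma sharedTotal_single (i : Fin n) (t : ℝ≥0) (ω : Ω) :
    sharedTotal (Pi.single i 1) N Y t ω = claimTotal (N i) (Y i) t ω := by
  simp [sharedTotal, Pi.single_apply]

/-- The stand-alone ruin probability is a supersolution of the renewal equation of the claims. -/
lemma IsLossModel.le_mul_dyadicRuin_single (h : IsLossModel lam N Y P) (i : Fin n) {c : ℝ}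
    (hc0 : 0 ≤ c) (hc : lam i * meanClaim Y P i < c) {v : ℝ} (hv : 0 ≤ v) :
    lam i * ∫ ω, (∫ x in (0 : ℝ)..Y i 0 ω, dyadicRuin P (Pi.single i 1) N Y c (v - x)) ∂P ≤
      c * dyadicRuin P (Pi.single i 1) N Y c v := by
  set w : Fin n → ℝ := Pi.single i 1
  set ψ := dyadicRuin P w N Y c
  have hc' : ∑ j, lam j * w j * meanClaim Y P j < c := by
    simpa [w, Pi.single_apply] using hc
  have hψ : Antitone ψ := antitone_dyadicRuin w c
  have hYi := h.integrable_claim i 0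
  have hYm := h.measurable_claim i 0
  have hY0 := h.claim_nonneg i 0
  have hgrid : ∀ (m : ℕ) (v : ℝ), IsSublinear fun y =>
      ∫ x in (0 : ℝ)..y, gridRuin P w N Y c m (v - x) := fun m v =>
    isSublinear_primitive (antitone_gridRuin w c m) supTail_nonneg supTail_le_one v
  have hlimJ : Tendsto (fun m => ∫ ω, (∫ x in (0 : ℝ)..Y i 0 ω, gridRuin P w N Y c m (v - x)) ∂P)
      atTop (nhds (∫ ω, (∫ x in (0 : ℝ)..Y i 0 ω, ψ (v - x)) ∂P)) := by
    refine tendsto_integral_of_dominated_convergence (fun ω => Y i 0 ω)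
      (fun m => ((hgrid m v).integrable hYi hYm hY0).aestronglyMeasurable) hYi (fun m => ?_) ?_
    · filter_upwards [hY0] with ω hω
      rw [Real.norm_of_nonneg ((hgrid m v).nonneg _ hω)]
      exact (hgrid m v).le_self _ hω
    · refine ae_of_all _ fun ω => ?_
      refine intervalIntegral.tendsto_integral_filter_of_dominated_convergence (fun _ => 1)
        (Eventually.of_forall fun m => ?_) (Eventually.of_forall fun m => ae_of_all _ fun x _ => ?_)
        intervalIntegrable_const (ae_of_all _ fun x _ => h.tendsto_gridRuin w c (v - x))
      · exact ((antitone_gridRuin w c m).measurable.comp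
          (measurable_const.sub measurable_id)).aestronglyMeasurable
      · exact (Real.norm_of_nonneg (supTail_nonneg _)).trans_le (supTail_le_one _)
  have hlim : Tendsto (fun m => Real.exp (-(lam i * (dyadicTime m 1 : ℝ))) * lam i *
      (∫ ω, (∫ x in (0 : ℝ)..Y i 0 ω, gridRuin P w N Y c m (v - x)) ∂P -
        c * (dyadicTime m 1 : ℝ))) atTop
      (nhds (Real.exp (-(lam i * 0)) * lam i *
        (∫ ω, (∫ x in (0 : ℝ)..Y i 0 ω, ψ (v - x)) ∂P - c * 0))) := by
    have ht := tendsto_dyadicTime_one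
    exact (((Real.continuous_exp.tendsto _).comp (ht.const_mul _).neg).mul_const _).mul
      (hlimJ.sub (ht.const_mul c))
  rw [mul_zero, neg_zero, Real.exp_zero, one_mul, mul_zero, sub_zero] at hlim
  refine le_of_tendsto' hlim fun m => ?_
  set a := c * (dyadicTime m 1 : ℝ)
  have hpos := dyadicTime_one_pos m
  have ha : 0 ≤ a := mul_nonneg hc0 hpos.le
  have hanti := antitone_gridRuin (P := P) (N := N) (Y := Y) w c m
  have heq := h.intervalIntegral_gridRuin_eq hc' m hv
  have hle1 : ∫ u in v..v + a, gridRuin P w N Y c m u ≤ a * gridRuin P w N Y c m v := by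
    have h1 : ∫ _ in v..v + a, gridRuin P w N Y c m v = a * gridRuin P w N Y c m v := by
      rw [intervalIntegral.integral_const, add_sub_cancel_left, smul_eq_mul]
    rw [← h1]
    exact intervalIntegral.integral_mono_on (by linarith) hanti.intervalIntegrable
      intervalIntegrable_const fun u hu => hanti hu.1
  have hle2 := integral_sublinear_ge (h.poisson i) (h.measurable_claim i) (h.claim_nonneg i) hYi
    (h.claims_identDistrib i) (h.claims_indep_arrivals i) (dyadicTime m 1) (hgrid m (v + a))
  -- Here the base level is `v`, so the integrand sits at `v + a - x`; for a tail with values in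
  -- `[0, 1]`, shifting the level by `a` lowers the integral by at most `a`, which vanishes with the
  -- mesh.
  have hle3 : ∫ ω, (∫ x in (0 : ℝ)..Y i 0 ω, gridRuin P w N Y c m (v - x)) ∂P - a ≤
      ∫ ω, (∫ x in (0 : ℝ)..Y i 0 ω, gridRuin P w N Y c m (v + a - x)) ∂P := by
    have h1 : ∫ ω, (∫ x in (0 : ℝ)..Y i 0 ω, gridRuin P w N Y c m (v - x)) ∂P - a =
        ∫ ω, ((∫ x in (0 : ℝ)..Y i 0 ω, gridRuin P w N Y c m (v - x)) - a) ∂P := by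
      rw [integral_sub ((hgrid m v).integrable hYi hYm hY0) (integrable_const _)]
      simp
    rw [h1]
    refine integral_mono_ae (((hgrid m v).integrable hYi hYm hY0).sub (integrable_const _))
      ((hgrid m (v + a)).integrable hYi hYm hY0) (ae_of_all _ fun ω => ?_)
    have hi : ∀ x y, IntervalIntegrable (gridRuin P w N Y c m) volume x y :=
      fun _ _ => hanti.intervalIntegrable
    simp only
    rw [intervalIntegral.integral_comp_sub_left, intervalIntegral.integral_comp_sub_left,
      sub_zero, sub_zero]
    set y := Y i 0 ω
    have e1 := intervalIntegral.integral_add_adjacent_intervals (hi (v - y) (v + a - y))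
      (hi (v + a - y) (v + a))
    have e2 := intervalIntegral.integral_add_adjacent_intervals (hi (v - y) v) (hi v (v + a))
    have e3 : 0 ≤ ∫ u in v..v + a, gridRuin P w N Y c m u :=
      intervalIntegral.integral_nonneg (by linarith) fun u _ => supTail_nonneg _
    have e4 := (le_abs_self _).trans (abs_intervalIntegral_le (φ := gridRuin P w N Y c m)
      supTail_nonneg supTail_le_one (v - y) (v + a - y))
    rw [show v + a - y - (v - y) = a by ring, abs_of_nonneg ha] at e4
    linarith
  have hle4 : gridRuin P w N Y c m v ≤ ψ v := gridRuin_le_dyadicRuin m v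
  simp_rw [w, sharedTotal_single] at heq
  set e := Real.exp (-(lam i * (dyadicTime m 1 : ℝ)))
  have he : 0 ≤ e := (Real.exp_pos _).le
  have hfin : dyadicTime m 1 * (e * lam i *
      (∫ ω, (∫ x in (0 : ℝ)..Y i 0 ω, gridRuin P w N Y c m (v - x)) ∂P - a)) ≤
      dyadicTime m 1 * (c * ψ v) := by
    calc dyadicTime m 1 * (e * lam i *
          (∫ ω, (∫ x in (0 : ℝ)..Y i 0 ω, gridRuin P w N Y c m (v - x)) ∂P - a))
        = e * (lam i * dyadicTime m 1) *
          (∫ ω, (∫ x in (0 : ℝ)..Y i 0 ω, gridRuin P w N Y c m (v - x)) ∂P - a) := by ring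
      _ ≤ e * (lam i * dyadicTime m 1) *
          ∫ ω, (∫ x in (0 : ℝ)..Y i 0 ω, gridRuin P w N Y c m (v + a - x)) ∂P :=
          mul_le_mul_of_nonneg_left hle3 (by positivity)
      _ ≤ _ := hle2
      _ = _ := heq.symm
      _ ≤ _ := hle1
      _ ≤ a * ψ v := mul_le_mul_of_nonneg_left hle4 ha
      _ = _ := by simp only [a]; ring
  exact le_of_mul_le_mul_left hfin hpos

/-- Comparison of the expected integrated tails: under fairness, the capacity constraint and a
common scale family, pooling reduces the right-hand side of the renewal equation. -/
lemma sum_integral_primitive_le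
    {A : Matrix (Fin n) (Fin n) ℝ} (hA : ∀ i j, 0 ≤ A i j)
    (hfair : ActuariallyFair A lam (meanClaim Y P)) (hcap : CapacityConstraint A (meanClaim Y P))
    (hscale : ScaleLossFamily Y (meanClaim Y P) P) (i : Fin n) {φ : ℝ → ℝ} (hφ : Antitone φ)
    (h0 : ∀ u, 0 ≤ φ u) (h1 : ∀ u, φ u ≤ 1) (v : ℝ) :
    ∑ j, lam j * ∫ ω, (∫ x in (0 : ℝ)..A i j * Y j 0 ω, φ (v - x)) ∂P ≤
      lam i * ∫ ω, (∫ x in (0 : ℝ)..Y i 0 ω, φ (v - x)) ∂P := by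
  obtain ⟨hb, Ω', _, Q, W, hQ, hWm, hW0, hWi, -, hlaw⟩ := hscale
  set b := meanClaim Y P
  have hsub := isSublinear_primitive hφ h0 h1 v
  have htransfer : ∀ j (r : ℝ), ∫ ω, (∫ x in (0 : ℝ)..r * Y j 0 ω, φ (v - x)) ∂P =
      ∫ ω, (∫ x in (0 : ℝ)..r * (b j * W ω), φ (v - x)) ∂Q := fun j r =>
    ((hlaw j 0).comp (u := fun y => ∫ x in (0 : ℝ)..r * y, φ (v - x))
      (hsub.measurable.comp (measurable_const_mul r))).integral_eq
  have hbi := hb i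
  have hint : ∀ r : ℝ, 0 ≤ r →
      Integrable (fun ω => ∫ x in (0 : ℝ)..r * W ω, φ (v - x)) Q := fun r hr =>
    hsub.integrable (hWi.const_mul r) (hWm.const_mul r) (ae_of_all _ fun ω => mul_nonneg hr (hW0 ω))
  set G : ℝ := ∫ ω, (∫ x in (0 : ℝ)..b i * W ω, φ (v - x)) ∂Q
  have hterm : ∀ j, ∫ ω, (∫ x in (0 : ℝ)..A i j * Y j 0 ω, φ (v - x)) ∂P ≤
      A i j * b j / b i * G := by
    intro j
    have hd : 0 ≤ A i j * b j := mul_nonneg (hA i j) (hb j).le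
    rw [htransfer, ← integral_const_mul]
    simp_rw [← mul_assoc]
    refine integral_mono (hint _ hd) ((hint _ hbi.le).const_mul _) fun ω => ?_
    -- The contraction ratio is at most one precisely by the capacity constraint.
    have := primitive_mul_le hφ v (r := A i j * b j / b i) (y := b i * W ω) (by positivity)
      ((div_le_one hbi).2 (hcap i j)) (mul_nonneg hbi.le (hW0 ω))
    rwa [← mul_assoc, div_mul_cancel₀ _ hbi.ne'] at this
  have hi : ∫ ω, (∫ x in (0 : ℝ)..Y i 0 ω, φ (v - x)) ∂P = G := by
    have := htransfer i 1
    simp only [one_mul] at this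
    exact this
  calc ∑ j, lam j * ∫ ω, (∫ x in (0 : ℝ)..A i j * Y j 0 ω, φ (v - x)) ∂P
      ≤ ∑ j, lam j * (A i j * b j / b i * G) :=
        Finset.sum_le_sum fun j _ => mul_le_mul_of_nonneg_left (hterm j) (lam j).2
    _ = (∑ j, lam j * A i j * b j) / b i * G := by
        rw [Finset.sum_div, Finset.sum_mul]
        exact Finset.sum_congr rfl fun j _ => by ring
    _ = lam i * G := by rw [← hfair i, mul_div_cancel_right₀ _ hbi.ne']
    _ = _ := by rw [hi]

/-- Pooling does not increase the dyadic ruin probability. -/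
lemma IsLossModel.dyadicRuin_le (h : IsLossModel lam N Y P) {η : ℝ} (hη : 0 < η)
    {A : Matrix (Fin n) (Fin n) ℝ} (hA : ∀ i j, 0 ≤ A i j)
    (hfair : ActuariallyFair A lam (meanClaim Y P)) (hcap : CapacityConstraint A (meanClaim Y P))
    (hscale : ScaleLossFamily Y (meanClaim Y P) P) (i : Fin n) (u : ℝ) :
    dyadicRuin P (A i) N Y (contributionRate η lam Y P i) u ≤
      dyadicRuin P (Pi.single i 1) N Y (contributionRate η lam Y P i) u := by
  have hb := hscale.1 i
  have hl : (0 : ℝ) < lam i := h.intensity_pos i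
  have hlb := mul_pos hl hb
  set c := contributionRate η lam Y P i with hcdef
  unfold contributionRate at hcdef
  have hc : lam i * meanClaim Y P i < c := by rw [hcdef]; nlinarith
  have hc0 : 0 < c := hlb.trans hc
  set ψ := dyadicRuin P (A i) N Y c
  set χ := dyadicRuin P (Pi.single i 1) N Y c
  have hψ : Antitone ψ := antitone_dyadicRuin _ _
  have hχ : Antitone χ := antitone_dyadicRuin _ _
  have hψs := fun v => isSublinear_primitive hψ supTail_nonneg supTail_le_one v
  have hχs := fun v => isSublinear_primitive hχ supTail_nonneg supTail_le_one v
  have hYi := h.integrable_claim i 0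
  have hYm := h.measurable_claim i 0
  have hY0 := h.claim_nonneg i 0
  -- A uniform error `s` enters the right-hand side as `λ_i b_i s`; dividing by `c = (1 + η) λ_i
  -- b_i` leaves `s / (1 + η)`.
  have hcontract : ∀ s : ℝ, 0 ≤ s → (∀ v, ψ v ≤ χ v + s) → ∀ v, ψ v ≤ χ v + s / (1 + η) := by
    intro s hs hle
    have hpos : ∀ v, 0 < v → ψ v ≤ χ v + s / (1 + η) := by
      intro v hv
      have h1 := h.mul_dyadicRuin_le (hA i) hc0.le (by rw [← hfair i]; exact hc) hv
      have h2 := sum_integral_primitive_le hA hfair hcap hscale i hψ supTail_nonneg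
        supTail_le_one v
      have h3 := h.le_mul_dyadicRuin_single i hc0.le hc hv.le
      have h4 : ∫ ω, (∫ x in (0 : ℝ)..Y i 0 ω, ψ (v - x)) ∂P ≤
          ∫ ω, (∫ x in (0 : ℝ)..Y i 0 ω, χ (v - x)) ∂P + meanClaim Y P i * s := by
        unfold meanClaim
        rw [← integral_mul_const, ← integral_add ((hχs v).integrable hYi hYm hY0)
          (hYi.mul_const s)]
        refine integral_mono_ae ((hψs v).integrable hYi hYm hY0)
          (((hχs v).integrable hYi hYm hY0).add (hYi.mul_const s)) ?_
        filter_upwards [hY0] with ω hω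
        have h5 : ∫ _ in (0 : ℝ)..Y i 0 ω, s = Y i 0 ω * s := by
          rw [intervalIntegral.integral_const, sub_zero, smul_eq_mul]
        rw [← h5, ← intervalIntegral.integral_add (intervalIntegrable_comp_sub hχ v _ _)
          intervalIntegrable_const]
        exact intervalIntegral.integral_mono_on hω (intervalIntegrable_comp_sub hψ v _ _)
          ((intervalIntegrable_comp_sub hχ v _ _).add intervalIntegrable_const)
          fun x _ => hle _
      have h6 := mul_le_mul_of_nonneg_left h4 hl.le
      have h7 : c * ψ v ≤ c * (χ v + s / (1 + η)) := by
        have h8 : c * (s / (1 + η)) = lam i * meanClaim Y P i * s := by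
          rw [hcdef]
          field_simp
        rw [mul_add, h8]
        linarith
      exact le_of_mul_le_mul_left h7 hc0
    intro v
    rcases lt_trichotomy v 0 with hv | rfl | hv
    · have e1 : ψ v = 1 := dyadicRuin_of_neg hv
      have e2 : χ v = 1 := dyadicRuin_of_neg hv
      rw [e1, e2]
      have : 0 ≤ s / (1 + η) := by positivity
      linarith
    -- The subsolution inequality is available only for positive levels; level `0` follows by
    -- right-continuity of the pooled tail and monotonicity of the stand-alone one.
    · refine le_of_tendsto' (tendsto_supTail_add 0) fun k => ?_
      have hk : (0 : ℝ) < 0 + 1 / ((k : ℝ) + 1) := by positivity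
      have := hpos _ hk
      have h2 := hχ hk.le
      exact this.trans (by linarith)
    · exact hpos v hv
  -- The iteration starts from error `1`, trivial because both tails lie in `[0, 1]`.
  have hiter : ∀ (k : ℕ) v, ψ v ≤ χ v + (1 / (1 + η)) ^ k := by
    intro k
    induction k with
    | zero =>
      intro v
      have e1 : ψ v ≤ 1 := supTail_le_one v
      have e2 : 0 ≤ χ v := supTail_nonneg v
      simpa using e1.trans (by linarith)
    | succ k ih =>
      intro v
      have := hcontract _ (by positivity) ih v
      rwa [pow_succ, mul_one_div]
  have hlim : Tendsto (fun k : ℕ => χ u + (1 / (1 + η)) ^ k) atTop (nhds (χ u + 0)) := by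
    refine (tendsto_pow_atTop_nhds_zero_of_lt_one (by positivity) ?_).const_add _
    rw [div_lt_one (by linarith)]
    linarith
  rw [add_zero] at hlim
  exact ge_of_tendsto' hlim fun k => hiter k u

end Model

end LinearRiskSharing

end

theorem proposition3p8 {Ω : Type*} [MeasurableSpace Ω] (P : Measure Ω) [IsProbabilityMeasure P]
    {n : ℕ} (lam : Fin n → ℝ≥0) (N : Fin n → ℝ≥0 → Ω → ℕ) (Y : Fin n → ℕ → Ω → ℝ)
    (hmodel : LinearRiskSharing.IsLossModel lam N Y P)
    (η : ℝ) (hη : 0 < η)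
    (A : Matrix (Fin n) (Fin n) ℝ) (hA : A ∈ Matrix.colStochastic ℝ (Fin n))
    (hfair : LinearRiskSharing.ActuariallyFair A lam (LinearRiskSharing.meanClaim Y P))
    (hcap : LinearRiskSharing.CapacityConstraint A (LinearRiskSharing.meanClaim Y P))
    (hscale : LinearRiskSharing.ScaleLossFamily Y (LinearRiskSharing.meanClaim Y P) P) :
    ∀ (i : Fin n) (κ : ℝ), 0 ≤ κ →
      LinearRiskSharing.pooledRuinProb η A lam N Y P i κ ≤
        LinearRiskSharing.standAloneRuinProb η lam N Y P i κ := by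
  intro i κ _
  unfold LinearRiskSharing.pooledRuinProb LinearRiskSharing.standAloneRuinProb
  rw [hmodel.ruinProb_eq (A i) _ κ (hmodel.ae_claimTotal_poolCount_eq A i),
    hmodel.ruinProb_eq (Pi.single i 1) _ κ
      (ae_of_all _ fun ω t => (LinearRiskSharing.sharedTotal_single i t ω).symm)]
  exact ENNReal.ofReal_le_ofReal
    (hmodel.dyadicRuin_le hη (fun _ _ => hA.1 _ _) hfair hcap hscale i κ)
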